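/- **Notation.** Let $\diamond\in\{\square,\blacksquare\}$, where $\blacksquare$ denotes the horizontal domino; let $\mathcal P^{\square}$ be the set of all partitions and $\mathcal P^{\blacksquare}$ the set of partitions all of whose rows have even length. Let $n\ge L\ge 0$ be integers and $\lambda$ a partition. Let $B_\emptyset^1=\{1,\dots,n\}$, $B_\square^1=\{1,\dots,n,0,\bar n,\dots,\bar 1\}\cup\{\varnothing\}$ and $B_\blacksquare^1=\{1,\dots,n,\bar n,\dots,\bar 1\}$ be the vector crystals of classical types $A_{n-1}$, $B_n$ (plus a trivial component $\varnothing$) and $C_n$. For $\diamond\in\{\emptyset,\square,\blacksquare\}$ let $P_\diamond(1^L,\lambda)$ be the set of classical highest weight vectors $b=b_L\otimes\cdots\otimes b_1$ of weight $\lambda$ in $(B_\diamond^1)^{\otimes L}$, for the tensor product rule in which $e_i(b_2\otimes b_1)=e_i(b_2)\otimes b_1$ if $\varepsilon_i(b_2)>\varphi_i(b_1)$ and $=b_2\otimes e_i(b_1)$ otherwise. (Since $n\ge L$, these are the words without the letter $0$ such that each $b_i\cdots b_1$ has a partition as its weight, the weight of the whole word being $\lambda$.) For $c=c_L\cdots c_1\in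 P_\emptyset(1^L,\tau)$ let $P(c)$ be the standard tableau of shape $\tau$ that has the letter $i$ in row $c_i$. Tableaux are identified with their row words, and $[w]$ is the unique tableau of partition shape that is Knuth equivalent to the word $w$. For $c \in P_\emptyset(1^L,\tau)$ the set $\mathrm{LR}(\tau;\lambda,\mu)$ is realized as the set of pairs $T\otimes S$ of semistandard tableaux of shapes $\lambda$ and $\mu$ with $[T\cdot S]=P(c)$. **The DDF map.** Let $b=b_L\cdots b_1\in P_\diamond(1^L,\lambda)$. 1. Start with the empty tableau $T$ and the empty involution $I$. For $i=1,\dots,L$: if $b_i=r$, adjoin the letter $i$ at the end of row $r$ of $T$; if $b_i=\bar r$, apply reverse row insertion to $T$ at the corner cell in row $r$, let $a$ be the ejected letter, and add the $2$-cycle $(a,i)$ to $I$; if $b_i=\varnothing$, add the fixed point $i$ to $I$. This gives a tableau $T$ and an involution $I$ of a set $A\subset\{1,\dots,L\}$. 2. Write $A=\{a_1<\cdots<a_k\}$ and $u=I(a_k)\cdots I(a_2)I(a_1)$. Let $S$ be obtained from the empty tableau by column inserting the letters of $u$, starting at the right end of $u$ (Burge correspondence). 3. Let $P$ be obtained from $T$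 by row inserting the letters of $u$, starting at the left end of $u$, and let $c=c_L\cdots c_1$ be the word such that the letter $i$ of $P$ is in row $c_i$. The DDF map is $b\mapsto(c,\,T\otimes S)$. **Proposition.** For every $b\in P_\diamond(1^L,\lambda)$ the shape of $S$ belongs to $\mathcal P^\diamond$, $P$ is the standard tableau $P(c)$, and $P=[T\cdot S]$. The DDF map is a bijection $$P_\diamond(1^L,\lambda)\;\longrightarrow\;\bigcup_{\tau}\;\bigcup_{\mu\in\mathcal P^\diamond}P_\emptyset(1^L,\tau)\times\mathrm{LR}(\tau;\lambda,\mu),$$ where $\tau$ runs over all partitions and, in the part belonging to $c\in P_\emptyset(1^L,\tau)$, $\mathrm{LR}(\tau;\lambda,\mu)$ is formed with the tableau $P(c)$. -/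

import Mathlib

namespace DDF

/-! ### Classical highest weight vectors in tensor powers of the vector crystals -/

/-- The types `∅`, `□` and the horizontal domino. Their classical subalgebras of rank parameter `n`
are of type `A_{n-1}`, `B_n` and `C_n` respectively. -/
inductive Diamond
  | empty
  | box
  | domino
  deriving DecidableEq

/-- The letters of the crystals `B_◇^1`. The index `r : ℕ` is zero-based: `plain r` is the letter
`r + 1` and `bar r` is the barred letter `r + 1`; `empty` is the symbol `∅`. -/
inductive Letter
  | plain (r : ℕ)
  | bar (r : ℕ)
  | zero
  | empty
  deriving DecidableEq

/-- The underlying set of `B_◇^1` at rank `n`: it is `{1, …, n}` for type `∅`,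
`{1, …, n, 0, n̄, …, 1̄} ∪ {∅}` for type `□`, and `{1, …, n, n̄, …, 1̄}` for the domino. -/
def InB (d : Diamond) (n : ℕ) : Letter → Prop
  | .plain r => r < n
  | .bar r => d ≠ .empty ∧ r < n
  | .zero => d = .box
  | .empty => d = .box

/-- The number of classical Dynkin nodes: `n - 1` in type `A_{n-1}`, and `n` in types `B_n`, `C_n`.
The nodes are numbered from `0`, so that node `i : ℕ` is the usual node `i + 1`. -/
def nodes (n : ℕ) : Diamond → ℕ
  | .empty => n - 1
  | .box => n
  | .domino => n

/-- The length of the string through the letter `n` for the last node, which is `n → 0 → n̄` in type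
`B_n` and `n → n̄` in type `C_n`; for every other node nontrivial strings have length `1`. -/
def stringLen (d : Diamond) (n i : ℕ) : ℕ :=
  if d = .box ∧ i + 1 = n then 2 else 1

/-- `ε_i` on letters, in the crystal graphs
`A_{n-1}: 1 → 2 → ⋯ → n`, `B_n: 1 → ⋯ → n → 0 → n̄ → ⋯ → 1̄` and an isolated vertex `∅`,
`C_n: 1 → ⋯ → n → n̄ → ⋯ → 1̄`,
where for `i < n` the arrows of colour `i` are `i → i + 1` and from barred `i + 1` to barred `i`,
and the remaining arrows in the middle have colour `n`. -/
def eps (d : Diamond) (n i : ℕ) : Letter → ℕ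
  | .plain r => if r = i + 1 then 1 else 0
  | .bar r => if r = i then stringLen d n i else 0
  | .zero => if i + 1 = n then 1 else 0
  | .empty => 0

/-- `φ_i` on letters, in the same crystal graphs. -/
def phi (d : Diamond) (n i : ℕ) : Letter → ℕ
  | .plain r => if r = i then stringLen d n i else 0
  | .bar r => if r = i + 1 then 1 else 0
  | .zero => if i + 1 = n then 1 else 0
  | .empty => 0

/-- A tensor `b_L ⊗ ⋯ ⊗ b_2 ⊗ b_1` is the list `[b_L, …, b_2, b_1]`. By the tensor product rule
(`f_i` acts on the left factor of `b₂ ⊗ b₁` iff `ε_i(b₂) ≥ φ_i(b₁)`),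
`φ_i(b₂ ⊗ b₁) = φ_i(b₂) + max(0, φ_i(b₁) - ε_i(b₂))`. -/
def phiWord (d : Diamond) (n i : ℕ) : List Letter → ℕ
  | [] => 0
  | x :: w => phi d n i x + (phiWord d n i w - eps d n i x)

/-- By the tensor product rule (`e_i` acts on the left factor of `b₂ ⊗ b₁` iff `ε_i(b₂) > φ_i(b₁)`),
`ε_i(b₂ ⊗ b₁) = ε_i(b₁) + max(0, ε_i(b₂) - φ_i(b₁))`. -/
def epsWord (d : Diamond) (n i : ℕ) : List Letter → ℕ
  | [] => 0
  | x :: w => epsWord d n i w + (eps d n i x - phiWord d n i w)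

/-- The weight of a word: its `r`-th coordinate (`r` zero-based) is the number of letters `r` minus
the number of barred letters `r`. -/
def wt (w : List Letter) (r : ℕ) : ℤ :=
  (w.count (.plain r) : ℤ) - (w.count (.bar r) : ℤ)

/-- `P_◇(1^L, λ)` at rank `n`: the classical highest weight vectors of weight `λ` in the `L`-th
tensor power of `B_◇^1`. -/
def hwPaths (d : Diamond) (n L : ℕ) (lam : YoungDiagram) : Set (List Letter) :=
  {b | b.length = L ∧ (∀ x ∈ b, InB d n x) ∧ (∀ i < nodes n d, epsWord d n i b = 0) ∧
    ∀ r, wt b r = (lam.rowLen r : ℤ)}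

/-- The partitions whose diagrams can be tiled by `◇`: only the empty partition for `∅`, all
partitions for `□`, the partitions with even rows for the horizontal domino. -/
def tiled : Diamond → Set YoungDiagram
  | .empty => {⊥}
  | .box => Set.univ
  | .domino => {μ | ∀ i, Even (μ.rowLen i)}

/-! ### Tableaux, Knuth equivalence, insertion -/

/-- A filling of a diagram, as the list of its rows from top to bottom. -/
abbrev Filling := List (List ℕ)

/-- The rows of a semistandard tableau. -/
def rows {μ : YoungDiagram} (t : SemistandardYoungTableau μ) : Filling :=
  (List.range (μ.colLen 0)).map fun i => (List.range (μ.rowLen i)).map fun j => t i j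

/-- `T` is (the list of rows of) a semistandard tableau of shape `μ`. -/
def IsTableau (μ : YoungDiagram) (T : Filling) : Prop :=
  ∃ t : SemistandardYoungTableau μ, rows t = T

/-- The row word: the rows are read from left to right, starting with the bottom row. -/
def rowWord (T : Filling) : List ℕ :=
  T.reverse.flatten

/-- The elementary Knuth transformations. -/
inductive KnuthStep : List ℕ → List ℕ → Prop
  | xzy (u v : List ℕ) (x y z : ℕ) : x ≤ y → y < z →
      KnuthStep (u ++ [x, z, y] ++ v) (u ++ [z, x, y] ++ v)
  | yxz (u v : List ℕ) (x y z : ℕ) : x < y → y ≤ z →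
      KnuthStep (u ++ [y, x, z] ++ v) (u ++ [y, z, x] ++ v)

/-- Knuth equivalence of words. For a tableau `P`, `P = [w]` means that `w` is Knuth equivalent to
the row word of `P`. -/
def KnuthEquiv : List ℕ → List ℕ → Prop :=
  Relation.EqvGen KnuthStep

/-- Littlewood-Richardson data for a fixed tableau `P`: the pairs `(T, S)` of tableaux of shapes `λ`
and `μ` with `P = [T · S]`. -/
def LR (P : Filling) (lam μ : YoungDiagram) : Set (Filling × Filling) :=
  {p | IsTableau lam p.1 ∧ IsTableau μ p.2 ∧
    KnuthEquiv (rowWord p.1 ++ rowWord p.2) (rowWord P)}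

/-- Put `x` in the place of the first entry `y` with `r x y` and return that `y` as well; if there
is no such entry, put `x` at the end. -/
def bump (r : ℕ → ℕ → Prop) [DecidableRel r] (x : ℕ) : List ℕ → List ℕ × Option ℕ
  | [] => ([x], none)
  | y :: ys =>
    if r x y then (x :: ys, some y)
    else ((y :: (bump r x ys).1), (bump r x ys).2)

/-- Insert `x` into the first line, the bumped entry into the second line, and so on. -/
def insertLines (r : ℕ → ℕ → Prop) [DecidableRel r] (x : ℕ) : List (List ℕ) → List (List ℕ)
  | [] => [[x]]
  | R :: Rs =>
    match bump r x R with
    | (R', none) => R' :: Rs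
    | (R', some y) => R' :: insertLines r y Rs

/-- Exchange rows and columns. -/
def transpose (T : Filling) : Filling :=
  (List.range (T.headD []).length).map fun j => T.filterMap fun R => R[j]?

/-- Row insertion `T ← x`: the leftmost entry larger than `x` is bumped into the next row. -/
def rowInsert (T : Filling) (x : ℕ) : Filling :=
  insertLines (· < ·) x T

/-- Column insertion `x → T`: the topmost entry larger than or equal to `x` is bumped into the next
column. -/
def colInsert (x : ℕ) (T : Filling) : Filling :=
  transpose (insertLines (· ≤ ·) x (transpose T))

/-- Undo the bumping of `x` from a row: `x` takes the place of the rightmost entry smaller than `x`,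
and that entry is returned. (The row is weakly increasing and starts with an entry smaller than `x`;
the case of an empty row does not occur.) -/
def unbump (x : ℕ) : List ℕ → List ℕ × ℕ
  | [] => ([], x)
  | [y] => ([x], y)
  | y :: z :: ys =>
    if z < x then (y :: (unbump x (z :: ys)).1, (unbump x (z :: ys)).2)
    else (x :: z :: ys, y)

/-- Reverse row insertion at the corner cell in row `r` (zero-based): the resulting filling and the
letter that is ejected from the first row. (The case of a missing row does not occur.) -/
def reverseInsert : ℕ → Filling → Filling × ℕ
  | _, [] => ([], 0)
  | 0, R :: Rs => (if R.dropLast = [] then Rs else R.dropLast :: Rs, R.getLastD 0)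
  | r + 1, R :: Rs =>
    ((unbump (reverseInsert r Rs).2 R).1 :: (reverseInsert r Rs).1,
      (unbump (reverseInsert r Rs).2 R).2)

/-- Adjoin the letter `i` at the end of row `r` (zero-based). (The case of a row below the first
empty one does not occur.) -/
def adjoin (i : ℕ) : ℕ → Filling → Filling
  | 0, [] => [[i]]
  | 0, R :: Rs => (R ++ [i]) :: Rs
  | _ + 1, [] => []
  | r + 1, R :: Rs => R :: adjoin i r Rs

/-! ### Yamanouchi words and standard tableaux -/

/-- The standard tableau of a Yamanouchi word `c = c_L ⋯ c_1`: the letter `i` is in row `c_i`. -/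
def stdTableau : List Letter → Filling
  | [] => []
  | .plain r :: c => adjoin (c.length + 1) r (stdTableau c)
  | _ :: c => stdTableau c

/-- The word `c = c_L ⋯ c_1` of a standard tableau `P` with letters `1, …, L`: `c_i` is the row of
the letter `i`. -/
def yamanouchi (L : ℕ) (P : Filling) : List Letter :=
  (List.range' 1 L).reverse.map fun i => .plain (P.findIdx fun R => decide (i ∈ R))

/-! ### The DDF map -/

/-- The extended Delest-Dulucq-Favreau map `b ↦ (T, I)`. The involution `I` on a set `A` of positive
integers is the partial function with `I a = some (I(a))` for `a ∈ A` and `I a = none` for `a ∉ A`.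
(The letter `0` does not occur in highest weight vectors when the rank is large.) -/
def ddfData : List Letter → Filling × (ℕ → Option ℕ)
  | [] => ([], fun _ => none)
  | x :: b =>
    let i := b.length + 1
    let T := (ddfData b).1
    let I := (ddfData b).2
    match x with
    | .plain r => (adjoin i r T, I)
    | .bar r =>
      let a := (reverseInsert r T).2
      ((reverseInsert r T).1, Function.update (Function.update I a (some i)) i (some a))
    | .empty => (T, Function.update I i (some i))
    | .zero => (T, I)

/-- The tableau `T`. -/
def ddfT (b : List Letter) : Filling :=
  (ddfData b).1

/-- The lower word of the biword of the involution `I`, whose upper word is the domain `A` of `I` in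
decreasing order. It is also the lower word of the biword of `I w₀`, whose upper word is the set of
all `L + 1 - a` with `a ∈ A` in increasing order. -/
def ddfWord (b : List Letter) : List ℕ :=
  (List.range' 1 b.length).reverse.filterMap (ddfData b).2

/-- The tableau `S` of the Burge correspondence: column insert the word of `I`, starting at its right
end, into the empty tableau. -/
def ddfS (b : List Letter) : Filling :=
  (ddfWord b).foldr colInsert []

/-- The tableau `P`: row insert the word of `I w₀`, starting at its left end, into `T`. -/
def ddfP (b : List Letter) : Filling :=
  (ddfWord b).foldl rowInsert (ddfT b)

/-- The word `c` of `P`. -/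
def ddfC (b : List Letter) : List Letter :=
  yamanouchi b.length (ddfP b)

/-- The DDF map `b ↦ (c, T ⊗ S)`. -/
def ddfMap (b : List Letter) : List Letter × (Filling × Filling) :=
  (ddfC b, (ddfT b, ddfS b))

/-- The set `⋃_τ ⋃_{μ ∈ P^◇} P_∅(1^L, τ) × LR(τ; λ, μ)`, where in the factor belonging to
`c ∈ P_∅(1^L, τ)` the set `LR(τ; λ, μ)` is realized by means of the standard tableau of `c`, a
tableau of shape `τ`. -/
def target (d : Diamond) (n L : ℕ) (lam : YoungDiagram) :
    Set (List Letter × (Filling × Filling)) :=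
  ⋃ τ : YoungDiagram, ⋃ μ ∈ tiled d,
    {p | p.1 ∈ hwPaths .empty n L τ ∧ p.2 ∈ LR (stdTableau p.1) lam μ}

end DDF

/-!
# The Delest-Dulucq-Favreau map is a bijection

A standard tableau is encoded by its *code*, the list of the pairs (letter, row) in decreasing order
of the letters; the rows form a lattice word. On codes, row insertion is a simple recursion over the
largest letter `j`: if `j` occupies the cell that is new after inserting `x` into the rest of the
tableau, then `j` is bumped to the end of the next row, and otherwise nothing happens to it (`ins`,
`rowInsert_tab`). This is the local rule of a growth diagram, and the combinatorial facts about
insertion become inductions over this recursion.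

* Reverse insertion at a corner is inverse to insertion (`del_ins`, `ins_del`).
* Knuth equivalent words with distinct letters have the same insertion tableau, because the rows of
  the three cells created by the two sides of a Knuth relation differ by an elementary move of the
  same kind, which a larger letter preserves (`RowMove.slide`, `ins₃_xzy`, `ins₃_yzx`). As a tableau
  is the insertion tableau of its row word, it is determined by its Knuth class
  (`Valid.eq_of_knuthEquiv`).
* A new largest letter `m` at position `a` of a biword acts on the recording tableau as the row
  insertion of `a` (`rsk_update`). Hence the insertion tableau and the recording tableau of an
  involution agree, and adding a 2-cycle `(a, m)` to an involution inserts `a` into its tableau and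
  puts `m` at the end of the row below the new cell (`rsk_cycle`, Beissinger's algorithm).

For distinct letters column insertion is row insertion into the transpose, so `S` is the transpose
of the Robinson-Schensted tableau of the involution `I`. By the last item, the DDF map is then a
recursion on pairs of codes, for `T` and for the transpose of `S` (`codes`), in which every step is
invertible: the largest letter lies in `T` (the step was an unbarred letter), or in the first row of
the transpose of `S` (the letter `∅`), or below it (a barred letter). The highest weight condition
says that in every step the required cell can be added or removed (`highestWeight_iff`). So the map
`b ↦ (T, S)` is a bijection onto the pairs of tableaux whose sets of letters partition `{1, …, L}`,
as long as the letter `∅` is allowed.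

The alternating sum of the row lengths of a code is the number of odd columns of the tableau. A
2-cycle adds cells in two consecutive rows and does not change it, and a fixed point adds `1`;
therefore the number of odd rows of `S` is the number of letters `∅`, and words without this letter
correspond to tableaux `S` with even rows (`altSum_codes`, `altSum_eq_zero_iff`).

Finally `S` is Knuth equivalent to the word from which it is built, since reversing words with
distinct letters preserves Knuth equivalence and the reversed row word of a tableau is Knuth
equivalent to the row word of the transpose (`rowWord_transpose_equiv`). This gives `P = [T · S]`,
and by the uniqueness of the tableau in a Knuth class `c` is determined by `T` and `S`.
-/

namespace DDF

/-! ### Codes of standard tableaux -/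

/-- The code of a standard tableau: the pairs (letter, row) in decreasing order of the letters. -/
abbrev Code := List (ℕ × ℕ)

/-- The number of letters in row `s`. -/
def cnt (s : ℕ) (F : Code) : ℕ := (F.map Prod.snd).count s

/-- The letters of a code. -/
abbrev letters (F : Code) : List ℕ := F.map Prod.fst

@[simp] theorem cnt_nil (s : ℕ) : cnt s [] = 0 := rfl

theorem cnt_cons (s : ℕ) (p : ℕ × ℕ) (F : Code) :
    cnt s (p :: F) = cnt s F + if p.2 = s then 1 else 0 := by
  simp [cnt, List.count_cons]

/-- The lattice condition: all the shapes obtained by adding the letters in increasing order are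
partitions. -/
def Yam : Code → Prop
  | [] => True
  | p :: F => Yam F ∧ ∀ r, p.2 = r + 1 → cnt (r + 1) F < cnt r F

/-- The codes of standard tableaux: the letters decrease strictly and every shape is a partition. -/
structure IsStd (F : Code) : Prop where
  yam : Yam F
  sorted : (letters F).Pairwise (· > ·)

theorem Yam.cnt_le {F : Code} (h : Yam F) (r : ℕ) : cnt (r + 1) F ≤ cnt r F := by
  induction F with
  | nil => simp
  | cons p F ih =>
    have := ih h.1
    have h2 := h.2 r
    simp only [cnt_cons]
    split_ifs <;> grind

theorem Yam.lt_length {F : Code} (h : Yam F) {s : ℕ} (hs : 0 < cnt s F) : s < F.length := by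
  induction F generalizing s with
  | nil => simp at hs
  | cons p F ih =>
    have h2 := h.2
    rw [cnt_cons] at hs
    by_cases hp : p.2 = s
    · cases s with
      | zero => simp
      | succ r =>
        have := ih h.1 (s := r) (by have := h2 r hp; omega)
        simp; omega
    · have := ih h.1 (s := s) (by simpa [hp] using hs)
      simp; omega

theorem IsStd.tail {p : ℕ × ℕ} {F : Code} (h : IsStd (p :: F)) : IsStd F :=
  ⟨h.yam.1, (List.pairwise_cons.1 h.sorted).2⟩

theorem IsStd.lt_head {p : ℕ × ℕ} {F : Code} (h : IsStd (p :: F)) : ∀ x ∈ letters F, x < p.1 :=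
  (List.pairwise_cons.1 h.sorted).1

theorem IsStd.nodup {F : Code} (h : IsStd F) : (letters F).Nodup :=
  h.sorted.imp fun hab => ne_of_gt hab

/-! ### Row insertion of codes -/

/-- Row insertion of a letter into the code of a tableau, together with the row of the new cell. A
letter `j` that is larger than `x` and all the other letters is bumped exactly when it occupies the
cell that is new when `x` is inserted into the rest of the tableau. (The letters are distinct, so
the case `j = x` does not occur.) -/
def ins (x : ℕ) : Code → Code × ℕ
  | [] => ([(x, 0)], 0)
  | (j, s) :: F =>
    if j < x then ((x, 0) :: (j, s) :: F, 0)
    else if s = (ins x F).2 then ((j, s + 1) :: (ins x F).1, s + 1)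
    else ((j, s) :: (ins x F).1, (ins x F).2)

theorem ins_of_lt {x : ℕ} {F : Code} (h : ∀ y ∈ letters F, y < x) : ins x F = ((x, 0) :: F, 0) := by
  cases F with
  | nil => rfl
  | cons p F => simp [ins, h p.1 (by simp)]

theorem ins_cons_of_le {x j : ℕ} (h : x ≤ j) (s : ℕ) (F : Code) :
    ins x ((j, s) :: F) = if s = (ins x F).2 then ((j, s + 1) :: (ins x F).1, s + 1)
      else ((j, s) :: (ins x F).1, (ins x F).2) := by
  rw [ins, if_neg h.not_gt]

theorem cnt_ins (s x : ℕ) (F : Code) :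
    cnt s (ins x F).1 = cnt s F + if (ins x F).2 = s then 1 else 0 := by
  induction F with
  | nil => rw [ins, cnt_cons]
  | cons p F ih =>
    obtain ⟨j, t⟩ := p
    simp only [ins]
    split_ifs <;> simp_all [cnt_cons, add_right_comm]

theorem letters_ins (x : ℕ) (F : Code) : (letters (ins x F).1).Perm (x :: letters F) := by
  induction F with
  | nil => simp [ins]
  | cons p F ih =>
    obtain ⟨j, t⟩ := p
    simp only [ins]
    split_ifs
    · simp
    · exact (ih.cons j).trans (.swap _ _ _)
    · exact (ih.cons j).trans (.swap _ _ _)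

theorem Yam.ins {F : Code} (h : Yam F) (x : ℕ) : Yam (ins x F).1 := by
  induction F with
  | nil => simp [DDF.ins, Yam]
  | cons p F ih =>
    obtain ⟨j, t⟩ := p
    have h1 := ih h.1
    have h2 := h.2
    have h3 := fun s => cnt_ins s x F
    have h4 := h.1.cnt_le
    simp only [DDF.ins]
    split_ifs with hj ht
    · exact ⟨h, by simp⟩
    · refine ⟨h1, fun r hr => ?_⟩
      have := h4 r
      simp only at hr ht
      rw [h3, h3, ← ht]
      split_ifs <;> omega
    · refine ⟨h1, fun r hr => ?_⟩
      have := h2 r hr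
      simp only at hr
      rw [h3, h3]
      split_ifs <;> omega

theorem IsStd.ins {F : Code} (h : IsStd F) {x : ℕ} (hx : x ∉ letters F) : IsStd (ins x F).1 := by
  refine ⟨h.yam.ins x, ?_⟩
  induction F with
  | nil => simp [DDF.ins]
  | cons p F ih =>
    obtain ⟨j, t⟩ := p
    have h1 := ih h.tail (by simp_all)
    have hj := h.lt_head
    have hmem := fun y => (letters_ins x F).mem_iff (a := y)
    have hs := h.sorted
    have hxj : x ≠ j := by rintro rfl; simp at hx
    simp only [DDF.ins]
    split_ifs with hlt <;>
      simp only [letters, List.map_cons, List.pairwise_cons] at hs ⊢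
    · refine ⟨?_, hs⟩
      intro y hy
      rcases List.mem_cons.1 hy with rfl | hy
      · exact hlt
      · exact (hs.1 y hy).trans hlt
    all_goals
      refine ⟨fun y hy => ?_, h1⟩
      rcases List.mem_cons.1 ((hmem y).1 hy) with rfl | hy
      · omega
      · exact hj y hy

/-- Reverse row insertion at the end of row `r`: the remaining code and the ejected letter. It reads
`ins` backwards. If the largest letter `j` is in the cell to be removed, then it was bumped there
from row `r - 1`, or it is itself the inserted letter if `r = 0`. (The empty code does not occur at
a corner of a tableau.) -/
def del (r : ℕ) : Code → Code × ℕ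
  | [] => ([], 0)
  | (j, s) :: F =>
    if s = r then
      match r with
      | 0 => (F, j)
      | r + 1 => ((j, r) :: (del r F).1, (del r F).2)
    else ((j, s) :: (del r F).1, (del r F).2)

theorem del_ins {F : Code} (x : ℕ) : del (ins x F).2 (ins x F).1 = (F, x) := by
  induction F with
  | nil => simp [ins, del]
  | cons p F ih =>
    obtain ⟨j, t⟩ := p
    simp only [ins]
    split_ifs with hj ht
    · simp [del]
    · subst ht; simp [del, ih]
    · simp [del, ht, ih]

/-- At a corner of a tableau, reverse insertion yields a tableau, a letter, and insertion of this
letter restores the original tableau. -/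
theorem ins_del {F : Code} (h : IsStd F) {r : ℕ} (hr : cnt (r + 1) F < cnt r F) :
    IsStd (del r F).1 ∧ (del r F).2 ∉ letters (del r F).1 ∧
      ins (del r F).2 (del r F).1 = (F, r) := by
  induction F generalizing r with
  | nil => simp at hr
  | cons p F ih =>
    obtain ⟨j, t⟩ := p
    have hlt := h.lt_head
    have hle := h.yam.cnt_le
    have hF := h.yam.1.cnt_le
    have hjt := h.yam.2
    -- the common part of the two cases in which the last letter survives
    have key : ∀ q u : ℕ, (IsStd (del q F).1 ∧ (del q F).2 ∉ letters (del q F).1 ∧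
        ins (del q F).2 (del q F).1 = (F, q)) →
        (∀ r, u = r + 1 → cnt (r + 1) (del q F).1 < cnt r (del q F).1) →
        IsStd ((j, u) :: (del q F).1) ∧ (del q F).2 ∉ letters ((j, u) :: (del q F).1) ∧
        (del q F).2 < j := by
      intro q u hq hu
      have hp := letters_ins (del q F).2 (del q F).1
      rw [hq.2.2] at hp
      have h1 : (del q F).2 < j := hlt _ (hp.mem_iff.2 (by simp))
      refine ⟨⟨⟨hq.1.yam, hu⟩, ?_⟩, ?_, h1⟩
      · simp only [letters, List.map_cons, List.pairwise_cons]
        exact ⟨fun y hy => hlt y (hp.mem_iff.2 (by simp [letters] at hy ⊢; exact Or.inr hy)),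
          hq.1.sorted⟩
      · simp only [letters, List.map_cons, List.mem_cons, not_or]
        exact ⟨by omega, hq.2.1⟩
    have hcnt : ∀ q, (ins (del q F).2 (del q F).1 = (F, q)) → ∀ s,
        cnt s F = cnt s (del q F).1 + if q = s then 1 else 0 := by
      intro q hq s
      have := cnt_ins s (del q F).2 (del q F).1
      rwa [hq] at this
    simp only [cnt_cons] at hr hle
    by_cases htr : t = r
    · subst htr
      cases t with
      | zero =>
        simp only [del, if_true]
        refine ⟨h.tail, fun hmem => ?_, ins_of_lt hlt⟩
        have := hlt _ hmem
        simp at this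
      | succ q =>
        rw [del, if_pos rfl]
        have h1 := hjt q rfl
        have hq := ih h.tail (r := q) h1
        have hc := hcnt q hq.2.2
        have hk := key q q hq fun s hs => by
          have e1 := hc (s + 1)
          have e2 := hc s
          have := hF s
          subst hs
          simp at e1 e2 h1 hr
          have := hle s
          simp at this
          omega
        refine ⟨hk.1, hk.2.1, ?_⟩
        have : ¬ j < (del q F).2 := by omega
        simp [ins, this, hq.2.2]
    · simp only [del, if_neg htr]
      have hq := ih h.tail (r := r) (by simp [htr] at hr; split_ifs at hr <;> omega)
      have hc := hcnt r hq.2.2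
      have hk := key r t hq fun s hs => by
        have e1 := hc (s + 1)
        have e2 := hc s
        have e3 := hjt s hs
        subst hs
        by_cases hrs : r = s
        · subst hrs; simp at *; omega
        · simp [hrs] at e2; split_ifs at e1 <;> omega
      refine ⟨hk.1, hk.2.1, ?_⟩
      have : ¬ j < (del r F).2 := by omega
      simp [ins, this, hq.2.2, htr]

/-! ### Row insertion and Knuth relations -/

/-- Letters that are inserted in increasing order create cells in weakly higher rows. -/
theorem ins_row_le {x y : ℕ} (hxy : x < y) (F : Code) : (ins y (ins x F).1).2 ≤ (ins x F).2 := by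
  induction F with
  | nil => simp [ins, hxy]
  | cons p F ih =>
    obtain ⟨j, t⟩ := p
    have : ¬ y < x := by omega
    simp only [ins]
    split_ifs <;> simp [ins] <;> split_ifs <;> simp_all <;> omega

/-- The elementary moves between the triples of rows of the cells that are added when the two sides
of a Knuth relation are inserted. -/
def RowMove (p q : ℕ × ℕ × ℕ) : Prop :=
  (q.1 = p.2.1 ∧ q.2.1 = p.1 ∧ q.2.2 = p.2.2 ∧ p.2.1 < p.2.2 ∧ p.2.2 ≤ p.1) ∨
  (q.1 = p.1 ∧ q.2.1 = p.2.2 ∧ q.2.2 = p.2.1 ∧ p.2.1 ≤ p.1 ∧ p.1 < p.2.2)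

/-- The rows of the cells created by three insertions, and the resulting code. -/
def ins₃ (x y z : ℕ) (F : Code) : (ℕ × ℕ × ℕ) × Code :=
  (((ins x F).2, (ins y (ins x F).1).2, (ins z (ins y (ins x F).1).1).2),
    (ins z (ins y (ins x F).1).1).1)

/-- The effect of three insertions, creating cells in the rows `p`, on a larger letter in row `s`:
the rows of the cells that are created in the presence of this letter, and its final row. -/
def slide (s : ℕ) (p : ℕ × ℕ × ℕ) : (ℕ × ℕ × ℕ) × ℕ :=
  let s1 := if s = p.1 then s + 1 else s
  let s2 := if s1 = p.2.1 then s1 + 1 else s1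
  let s3 := if s2 = p.2.2 then s2 + 1 else s2
  ((if s = p.1 then s + 1 else p.1, if s1 = p.2.1 then s1 + 1 else p.2.1,
    if s2 = p.2.2 then s2 + 1 else p.2.2), s3)

theorem ins₃_cons {x y z j : ℕ} (s : ℕ) (F : Code) (hx : x ≤ j) (hy : y ≤ j) (hz : z ≤ j) :
    ins₃ x y z ((j, s) :: F) = ((slide s (ins₃ x y z F).1).1,
      (j, (slide s (ins₃ x y z F).1).2) :: (ins₃ x y z F).2) := by
  simp only [ins₃, slide, ins_cons_of_le hx]
  by_cases h1 : s = (ins x F).2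
  · simp only [if_pos h1, ins_cons_of_le hy]
    by_cases h2 : s + 1 = (ins y (ins x F).1).2
    · simp only [if_pos h2, ins_cons_of_le hz]
      split_ifs <;> simp_all
    · simp only [if_neg h2, ins_cons_of_le hz]
      split_ifs <;> simp_all
  · simp only [if_neg h1, ins_cons_of_le hy]
    by_cases h2 : s = (ins y (ins x F).1).2
    · simp only [if_pos h2, ins_cons_of_le hz]
      split_ifs <;> simp_all
    · simp only [if_neg h2, ins_cons_of_le hz]
      split_ifs <;> simp_all

/-- A larger letter preserves the elementary moves, and both sides of a move take it to the same
row. -/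
theorem RowMove.slide {p q : ℕ × ℕ × ℕ} (h : RowMove p q) (s : ℕ) :
    RowMove (slide s p).1 (slide s q).1 ∧ (slide s p).2 = (slide s q).2 := by
  obtain ⟨p1, p2, p3⟩ := p
  obtain ⟨q1, q2, q3⟩ := q
  simp only [RowMove, DDF.slide] at *
  rcases h with ⟨rfl, rfl, rfl, h1, h2⟩ | ⟨rfl, rfl, rfl, h1, h2⟩ <;>
  split_ifs <;> omega

/-- The Knuth relation `xzy ∼ zxy` for row insertion, with the relation between the new rows that
makes the induction over the largest letter work. -/
theorem ins₃_xzy {x y z : ℕ} (hxy : x < y) (hyz : y < z) (F : Code) :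
    RowMove (ins₃ x z y F).1 (ins₃ z x y F).1 ∧ (ins₃ x z y F).2 = (ins₃ z x y F).2 := by
  -- the case in which `z` is larger than all the letters of `F`
  have base : ∀ F : Code, ins z F = ((z, 0) :: F, 0) →
      (ins z (ins x F).1 = ((z, 0) :: (ins x F).1, 0)) →
      RowMove (ins₃ x z y F).1 (ins₃ z x y F).1 ∧ (ins₃ x z y F).2 = (ins₃ z x y F).2 := by
    intro F h1 h2
    have := ins_row_le hxy F
    have hzx : ¬ z < x := by omega
    have hzy : ¬ z < y := by omega
    simp only [ins₃, h1, h2, RowMove]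
    simp only [ins, hzx, hzy, if_false]
    split_ifs <;> simp_all [ins] <;> split_ifs <;> simp_all <;> omega
  induction F with
  | nil => exact base _ (by simp [ins]) (by simp [ins, hxy.trans hyz])
  | cons p F ih =>
    obtain ⟨j, t⟩ := p
    by_cases hj : j < z
    · apply base
      · simp [ins, hj]
      · simp only [ins]
        split_ifs <;> simp [ins, hj, hxy.trans hyz]
    · have hj' : z ≤ j := by omega
      rw [ins₃_cons _ _ (by omega) (by omega) (by omega),
        ins₃_cons _ _ (by omega) (by omega) (by omega)]
      have := ih.1.slide t
      exact ⟨this.1, by rw [ih.2, this.2]⟩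

/-- Letters that are inserted in decreasing order create cells in strictly lower rows. -/
theorem ins_row_lt {x y : ℕ} (hxy : x < y) (F : Code) : (ins y F).2 < (ins x (ins y F).1).2 := by
  have := hxy.not_gt
  induction F with
  | nil => simp [ins, this]
  | cons p F ih =>
    obtain ⟨j, t⟩ := p
    simp only [ins]
    split_ifs <;> simp [ins] <;> split_ifs <;> simp_all <;> omega

/-- The Knuth relation `yzx ∼ yxz` for row insertion, with the relation between the new rows. -/
theorem ins₃_yzx {x y z : ℕ} (hxy : x < y) (hyz : y < z) (F : Code) :
    RowMove (ins₃ y z x F).1 (ins₃ y x z F).1 ∧ (ins₃ y z x F).2 = (ins₃ y x z F).2 := by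
  -- the case in which `z` is larger than all the letters of `F`
  have base : ∀ F : Code, ins z (ins y F).1 = ((z, 0) :: (ins y F).1, 0) →
      (ins z (ins x (ins y F).1).1 = ((z, 0) :: (ins x (ins y F).1).1, 0)) →
      RowMove (ins₃ y z x F).1 (ins₃ y x z F).1 ∧ (ins₃ y z x F).2 = (ins₃ y x z F).2 := by
    intro F h1 h2
    have := ins_row_lt hxy F
    have hzx : ¬ z < x := by omega
    simp only [ins₃, h1, h2, RowMove]
    simp only [ins, hzx, if_false]
    split_ifs <;> simp_all
    omega
  induction F with
  | nil => exact base _ (by simp [ins, hyz]) (by simp [ins, hxy.not_gt, hyz])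
  | cons p F ih =>
    obtain ⟨j, t⟩ := p
    by_cases hj : j < z
    · apply base
      · simp only [ins]
        split_ifs <;> simp [ins, hj, hyz]
      · simp only [ins]
        split_ifs <;> simp [ins] <;> split_ifs <;> simp [ins, hj, hyz, hxy.trans hyz]
    · have hj' : z ≤ j := by omega
      rw [ins₃_cons _ _ (by omega) (by omega) (by omega),
        ins₃_cons _ _ (by omega) (by omega) (by omega)]
      have := ih.1.slide t
      exact ⟨this.1, by rw [ih.2, this.2]⟩

/-! ### The Robinson-Schensted correspondence for involutions -/

/-- The Robinson-Schensted correspondence for a biword of pairs (position, letter), in decreasing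
order of the positions: the codes of the insertion tableau and of the recording tableau. -/
def rsk : List (ℕ × ℕ) → Code × Code
  | [] => ([], [])
  | (p, v) :: w => ((ins v (rsk w).1).1, (p, (ins v (rsk w).1).2) :: (rsk w).2)

/-- The biword of a partial function on `{1, …, k}`. -/
def biword (I : ℕ → Option ℕ) : ℕ → List (ℕ × ℕ)
  | 0 => []
  | k + 1 =>
    match I (k + 1) with
    | some v => (k + 1, v) :: biword I k
    | none => biword I k

theorem biword_congr {I J : ℕ → Option ℕ} {k : ℕ} (h : ∀ i, 1 ≤ i → i ≤ k → I i = J i) :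
    biword I k = biword J k := by
  induction k with
  | zero => rfl
  | succ k ih =>
    rw [biword, biword, h (k + 1) (by omega) le_rfl, ih fun i h1 h2 => h i h1 (by omega)]

theorem mem_biword {I : ℕ → Option ℕ} {k : ℕ} {p : ℕ × ℕ} :
    p ∈ biword I k ↔ 1 ≤ p.1 ∧ p.1 ≤ k ∧ I p.1 = some p.2 := by
  induction k with
  | zero => simp [biword]; omega
  | succ k ih =>
    obtain ⟨i, v⟩ := p
    have : i ≤ k + 1 ↔ i ≤ k ∨ i = k + 1 := by omega
    rw [biword]
    split
    · next u hu =>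
      simp only [List.mem_cons, ih, Prod.mk.injEq]
      by_cases hi : i = k + 1
      · subst hi; simp [hu, eq_comm]
      · simp [hi, this]
    · next hu =>
      simp only [ih]
      by_cases hi : i = k + 1
      · subst hi; simp [hu]
      · simp [hi, this]

theorem letters_rsk_fst (w : List (ℕ × ℕ)) : (letters (rsk w).1).Perm (w.map Prod.snd) := by
  induction w with
  | nil => rfl
  | cons p w ih => exact (letters_ins _ _).trans (ih.cons _)

theorem letters_rsk_snd (w : List (ℕ × ℕ)) : letters (rsk w).2 = w.map Prod.fst := by
  induction w with
  | nil => rfl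
  | cons p w ih => simp [rsk, ih]

/-- A new largest letter `m` at position `a` acts on the recording tableau as row insertion of `a`,
and it ends up in the row of the cell that is created by this insertion. -/
theorem rsk_update {I : ℕ → Option ℕ} {a m k : ℕ} (ha : 1 ≤ a) (hak : a ≤ k) (hI : I a = none)
    (hm : ∀ p ∈ biword I k, p.2 < m) :
    rsk (biword (Function.update I a (some m)) k) =
      ((m, (ins a (rsk (biword I k)).2).2) :: (rsk (biword I k)).1,
        (ins a (rsk (biword I k)).2).1) := by
  induction k with
  | zero => omega
  | succ k ih =>
    by_cases hk : a = k + 1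
    · -- the new letter comes last, so it is added to the first row
      subst hk
      have e : biword (Function.update I (k + 1) (some m)) k = biword I k :=
        biword_congr fun i _ h2 => Function.update_of_ne (by omega) _ _
      have e2 : biword I (k + 1) = biword I k := by rw [biword, hI]
      rw [e2] at hm ⊢
      have e3 : ins (k + 1) (rsk (biword I k)).2 = ((k + 1, 0) :: (rsk (biword I k)).2, 0) := by
        apply ins_of_lt
        intro y hy
        rw [letters_rsk_snd, List.mem_map] at hy
        obtain ⟨p, hp, rfl⟩ := hy
        have := (mem_biword.1 hp).2.1
        omega
      have e4 : ins m (rsk (biword I k)).1 = ((m, 0) :: (rsk (biword I k)).1, 0) := by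
        apply ins_of_lt
        intro y hy
        rw [(letters_rsk_fst _).mem_iff, List.mem_map] at hy
        obtain ⟨p, hp, rfl⟩ := hy
        exact hm p hp
      rw [e3, biword, Function.update_self]
      simp [rsk, e, e4]
    · have e : (Function.update I a (some m)) (k + 1) = I (k + 1) :=
        Function.update_of_ne (Ne.symm hk) _ _
      rw [biword, biword, e]
      rw [biword] at hm
      split at *
      · next v hv =>
        rw [List.forall_mem_cons] at hm
        have h1 := ih (by omega) hm.2
        have h2 : ¬ m < v := by have := hm.1; simp at this; omega
        have h3 : ¬ k + 1 < a := by omega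
        have h4 : a ≤ k + 1 := hak
        by_cases h5 : (ins v (rsk (biword I k)).1).2 = (ins a (rsk (biword I k)).2).2
        · simp [rsk, h1, ins_cons_of_le h4, ins_cons_of_le (not_lt.1 h2), h5]
        · simp [rsk, h1, ins_cons_of_le h4, ins_cons_of_le (not_lt.1 h2), h5, Ne.symm h5]
      · exact ih (by omega) hm

/-- For an involution the insertion tableau and the recording tableau agree. A new 2-cycle `(a, m)`
with `m` larger than all the letters inserts `a` and adds `m` below the row of the new cell. -/
theorem rsk_cycle {I : ℕ → Option ℕ} {a k : ℕ} {F : Code} (ha : 1 ≤ a) (hak : a ≤ k)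
    (hI : I a = none) (hm : ∀ p ∈ biword I k, p.2 < k + 1) (h : rsk (biword I k) = (F, F)) :
    rsk (biword (Function.update (Function.update I a (some (k + 1))) (k + 1) (some a)) (k + 1)) =
      ((k + 1, (ins a F).2 + 1) :: (ins a F).1, (k + 1, (ins a F).2 + 1) :: (ins a F).1) := by
  have e : biword (Function.update (Function.update I a (some (k + 1))) (k + 1) (some a)) k =
      biword (Function.update I a (some (k + 1))) k :=
    biword_congr fun i _ h2 => Function.update_of_ne (by omega) _ _
  rw [biword, Function.update_self]
  have : ¬ k + 1 < a := by omega
  simp [rsk, e, rsk_update ha hak hI hm, h, ins, this]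

/-- A new fixed point, larger than all the letters, is added at the end of the first row. -/
theorem rsk_fixed {I : ℕ → Option ℕ} {k : ℕ} {F : Code}
    (hm : ∀ p ∈ biword I k, p.2 < k + 1) (h : rsk (biword I k) = (F, F)) :
    rsk (biword (Function.update I (k + 1) (some (k + 1))) (k + 1)) =
      ((k + 1, 0) :: F, (k + 1, 0) :: F) := by
  have e : biword (Function.update I (k + 1) (some (k + 1))) k = biword I k :=
    biword_congr fun i _ h2 => Function.update_of_ne (by omega) _ _
  have e4 : ins (k + 1) F = ((k + 1, 0) :: F, 0) := by
    apply ins_of_lt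
    intro y hy
    have := letters_rsk_fst (biword I k)
    rw [h] at this
    rw [this.mem_iff, List.mem_map] at hy
    obtain ⟨p, hp, rfl⟩ := hy
    exact hm p hp
  rw [biword, Function.update_self]
  simp [rsk, e, h, e4]

/-- The alternating sum of the lengths of the rows, which is the number of odd columns. -/
def altSum (F : Code) : ℤ := (F.map fun p => (-1) ^ p.2).sum

theorem altSum_cons (p : ℕ × ℕ) (F : Code) : altSum (p :: F) = (-1) ^ p.2 + altSum F := by
  simp [altSum]

theorem altSum_ins (x : ℕ) (F : Code) : altSum (ins x F).1 = altSum F + (-1) ^ (ins x F).2 := by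
  induction F with
  | nil => simp [ins, altSum]
  | cons p F ih =>
    obtain ⟨j, t⟩ := p
    simp only [ins]
    split_ifs <;> simp_all [altSum_cons] <;> ring

/-! ### The DDF map on codes -/

/-- One step of the DDF map on the pair of the codes of `T` and of the transpose of `S`, where `i`
is the new letter. (The letter `0` does not occur in the relevant words.) -/
def addLetter (i : ℕ) : Letter → Code × Code → Code × Code
  | .plain r, p => ((i, r) :: p.1, p.2)
  | .bar r, p => ((del r p.1).1,
      (i, (ins (del r p.1).2 p.2).2 + 1) :: (ins (del r p.1).2 p.2).1)
  | .empty, p => (p.1, (i, 0) :: p.2)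
  | .zero, p => p

/-- The inverse of `addLetter`, for the largest letter `i`: it lies in `T` after a step with an
unbarred letter, in the first row of the transpose of `S` after a step with `∅`, and in a lower row
after a step with a barred letter. (In the second of the four cases `i` does not occur at all, which
is impossible if the letters are `1, …, i`.) -/
def dropLetter (i : ℕ) (p : Code × Code) : Letter × (Code × Code) :=
  if i ∈ letters p.1 then (.plain (p.1.headD (0, 0)).2, (p.1.tail, p.2))
  else
    match p.2 with
    | [] => (.zero, p)
    | (_, 0) :: F => (.empty, (p.1, F))
    | (_, t + 1) :: F =>
      (.bar (ins (del t F).2 p.1).2, ((ins (del t F).2 p.1).1, (del t F).1))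

/-- The letter can be put in front of a highest weight word whose weight is the shape of `G`: the
cell to be added is the end of a row that is shorter than the row above it, and the cell to be
removed is a corner. -/
def Fits (G : Code) : Letter → Prop
  | .plain r => ∀ s, r = s + 1 → cnt (s + 1) G < cnt s G
  | .bar r => cnt (r + 1) G < cnt r G
  | .zero => False
  | .empty => True

/-- Codes of two standard tableaux whose sets of letters partition `{1, …, k}`. -/
structure IsPair (k : ℕ) (p : Code × Code) : Prop where
  fst : IsStd p.1
  snd : IsStd p.2
  mem : ∀ x, (x ∈ letters p.1 ∨ x ∈ letters p.2) ↔ 1 ≤ x ∧ x ≤ k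
  disj : ∀ x, x ∈ letters p.1 → x ∉ letters p.2

theorem IsStd.cons {F : Code} (h : IsStd F) {i s : ℕ} (hi : ∀ x ∈ letters F, x < i)
    (hs : ∀ r, s = r + 1 → cnt (r + 1) F < cnt r F) : IsStd ((i, s) :: F) :=
  ⟨⟨h.yam, hs⟩, List.pairwise_cons.2 ⟨hi, h.sorted⟩⟩

/-- The new cell of a row insertion is a corner. -/
theorem Yam.corner_ins {F : Code} (h : Yam F) (x : ℕ) :
    cnt ((DDF.ins x F).2 + 1) (DDF.ins x F).1 < cnt (DDF.ins x F).2 (DDF.ins x F).1 := by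
  have := h.cnt_le (DDF.ins x F).2
  simp only [cnt_ins]
  simp
  omega

theorem IsStd.letters_del {F : Code} (h : IsStd F) {r : ℕ} (hr : cnt (r + 1) F < cnt r F) (x : ℕ) :
    x ∈ letters F ↔ x = (del r F).2 ∨ x ∈ letters (del r F).1 := by
  have := (letters_ins (del r F).2 (del r F).1).mem_iff (a := x)
  rwa [(ins_del h hr).2.2, List.mem_cons] at this

theorem IsPair.addLetter {k : ℕ} {p : Code × Code} (h : IsPair k p) {x : Letter}
    (hx : Fits p.1 x) : IsPair (k + 1) (addLetter (k + 1) x p) ∧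
      dropLetter (k + 1) (addLetter (k + 1) x p) = (x, p) := by
  have h1 : ∀ x ∈ letters p.1, x < k + 1 := fun x hx => by
    have := (h.mem x).1 (Or.inl hx); omega
  have h2 : ∀ x ∈ letters p.2, x < k + 1 := fun x hx => by
    have := (h.mem x).1 (Or.inr hx); omega
  have h1' : k + 1 ∉ letters p.1 := fun hx => by have := h1 _ hx; omega
  have h2' : k + 1 ∉ letters p.2 := fun hx => by have := h2 _ hx; omega
  have hm := h.mem
  have hd := h.disj
  cases x with
  | plain r =>
    refine ⟨⟨h.fst.cons h1 hx, h.snd, fun x => ?_, fun x => ?_⟩, ?_⟩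
    · have := hm x
      simp only [DDF.addLetter, letters, List.map_cons, List.mem_cons] at this ⊢
      grind
    · have := hd x
      simp only [DDF.addLetter, letters, List.map_cons, List.mem_cons] at this h2' ⊢
      grind
    · simp [dropLetter, DDF.addLetter]
  | zero => exact hx.elim
  | empty =>
    refine ⟨⟨h.fst, h.snd.cons h2 (by simp), fun x => ?_, fun x => ?_⟩, ?_⟩
    · have := hm x
      simp only [DDF.addLetter, letters, List.map_cons, List.mem_cons] at this ⊢
      grind
    · have := hd x
      simp only [DDF.addLetter, letters, List.map_cons, List.mem_cons] at this h1' ⊢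
      grind
    · simp only [dropLetter, DDF.addLetter, h1', if_false]
  | bar r =>
    have hdel := ins_del h.fst hx
    have hmd := h.fst.letters_del hx
    have ha : (del r p.1).2 ∉ letters p.2 := hd _ ((hmd _).2 (Or.inl rfl))
    have hmi := fun x => (letters_ins (del r p.1).2 p.2).mem_iff (a := x)
    have hi : k + 1 ∉ letters (del r p.1).1 := fun hx => h1' ((hmd _).2 (Or.inr hx))
    have hi2 : k + 1 ∉ letters (ins (del r p.1).2 p.2).1 := by
      rw [hmi, List.mem_cons, not_or]
      refine ⟨fun he => h1' ((hmd _).2 (Or.inl he)), h2'⟩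
    refine ⟨⟨hdel.1, (h.snd.ins ha).cons (fun x hx => ?_) ?_, fun x => ?_, fun x => ?_⟩, ?_⟩
    · rcases List.mem_cons.1 ((hmi x).1 hx) with rfl | hx
      · exact h1 _ ((hmd _).2 (Or.inl rfl))
      · exact h2 _ hx
    · intro s hs
      have := h.snd.yam.corner_ins (del r p.1).2
      obtain rfl : s = _ := by simpa using hs.symm
      exact this
    · have e1 := hm x
      have e2 := hmd x
      have e3 := hmi x
      simp only [DDF.addLetter, letters, List.map_cons, List.mem_cons] at e1 e2 e3 ⊢
      rw [e3]
      grind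
    · have e1 := hd x
      have e2 := hmd x
      have e3 := hmi x
      have e4 := hdel.2.1
      simp only [DDF.addLetter, letters, List.map_cons, List.mem_cons] at e1 e2 e3 e4 hi ⊢
      rw [e3]
      grind
    · simp only [dropLetter, DDF.addLetter, hi, if_false, del_ins, hdel.2.2]

theorem IsPair.dropLetter {k : ℕ} {p : Code × Code} (h : IsPair (k + 1) p) :
    IsPair k (dropLetter (k + 1) p).2 ∧ Fits (dropLetter (k + 1) p).2.1 (dropLetter (k + 1) p).1 ∧
      DDF.addLetter (k + 1) (dropLetter (k + 1) p).1 (dropLetter (k + 1) p).2 = p := by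
  obtain ⟨G, F⟩ := p
  have hm := h.mem
  have hd := h.disj
  simp only at hm hd
  -- the largest letter is the first one of its code
  have head : ∀ F : Code, IsStd F → k + 1 ∈ letters F → (∀ x ∈ letters F, x ≤ k + 1) →
      ∃ s F', F = (k + 1, s) :: F' := by
    intro F hF hk hle
    cases F with
    | nil => simp at hk
    | cons q F =>
      rcases List.mem_cons.1 hk with hk | hk
      · exact ⟨q.2, F, by rw [hk]⟩
      · have h1 := hF.lt_head _ hk
        have h2 := hle q.1 (by simp)
        omega
  by_cases hk : k + 1 ∈ letters G
  · obtain ⟨s, G', rfl⟩ := head G h.fst hk fun x hx => ((hm x).1 (Or.inl hx)).2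
    have hlt := h.fst.lt_head
    simp only [DDF.dropLetter, hk, if_true]
    refine ⟨⟨h.fst.tail, h.snd, fun x => ?_, fun x hx => hd x ?_⟩, h.fst.yam.2, rfl⟩
    · have e1 := hm x
      have e2 := hlt x
      have e3 := hd x
      simp only [letters, List.map_cons, List.mem_cons, List.tail_cons] at e1 e2 e3 ⊢
      grind
    · exact List.mem_cons_of_mem _ hx
  · have hF : k + 1 ∈ letters F := by
      have := (hm (k + 1)).2 ⟨by omega, le_rfl⟩
      tauto
    obtain ⟨s, F', rfl⟩ := head F h.snd hF fun x hx => ((hm x).1 (Or.inr hx)).2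
    have hlt := h.snd.lt_head
    cases s with
    | zero =>
      simp only [DDF.dropLetter, hk, if_false]
      refine ⟨⟨h.fst, h.snd.tail, fun x => ?_, fun x hx => ?_⟩, trivial, rfl⟩
      · have e1 := hm x
        have e2 := hlt x
        have e3 := hd x
        simp only [letters, List.map_cons, List.mem_cons] at e1 e2 e3 ⊢
        grind
      · have := hd x hx
        simp only [letters, List.map_cons, List.mem_cons] at this ⊢
        tauto
    | succ t =>
      simp only [DDF.dropLetter, hk, if_false]
      have hc : cnt (t + 1) F' < cnt t F' := h.snd.yam.2 t rfl
      have hdel := ins_del h.snd.tail hc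
      have hmd := h.snd.tail.letters_del hc
      have ha : (del t F').2 ∉ letters G := fun hx =>
        hd _ hx (List.mem_cons_of_mem _ ((hmd _).2 (Or.inl rfl)))
      have hmi := fun x => (letters_ins (del t F').2 G).mem_iff (a := x)
      refine ⟨⟨h.fst.ins ha, hdel.1, fun x => ?_, fun x => ?_⟩, h.fst.yam.corner_ins _, ?_⟩
      · have e1 := hm x
        have e2 := hmd x
        have e3 := hmi x
        have e4 := hlt x
        have e5 : x ∈ letters G → x ≠ k + 1 := by rintro hx rfl; exact hk hx
        simp only [letters, List.map_cons, List.mem_cons] at e1 e2 e3 e4 e5 ⊢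
        rw [e3]
        grind
      · have e1 := hd x
        have e2 := hmd x
        have e3 := hmi x
        have e4 := hdel.2.1
        simp only [letters, List.map_cons, List.mem_cons] at e1 e2 e3 e4 ⊢
        rw [e3]
        grind
      · simp only [DDF.addLetter, del_ins, hdel.2.2]

/-- A barred letter adds cells in two consecutive rows, which cancel in the alternating sum. -/
theorem altSum_addLetter (i : ℕ) (x : Letter) (p : Code × Code) :
    altSum (addLetter i x p).2 = altSum p.2 + if x = .empty then 1 else 0 := by
  cases x with
  | bar r => simp only [addLetter, altSum_cons, altSum_ins, pow_succ]; simp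
  | _ => simp [addLetter, altSum_cons, add_comm]

/-- The DDF map on codes: the codes of `T` and of the transpose of `S`. -/
def codes : List Letter → Code × Code
  | [] => ([], [])
  | x :: b => addLetter (b.length + 1) x (codes b)

/-- Every letter fits to the word on its right. For words whose length does not exceed the rank this
is the highest weight condition, by `highestWeight_iff`. -/
def HighestWeight : List Letter → Prop
  | [] => True
  | x :: b => HighestWeight b ∧ Fits (codes b).1 x

theorem HighestWeight.isPair {b : List Letter} (h : HighestWeight b) :
    IsPair b.length (codes b) := by
  induction b with
  | nil => exact ⟨⟨trivial, by simp [codes]⟩, ⟨trivial, by simp [codes]⟩,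
      fun x => by simp [codes]; omega, by simp [codes]⟩
  | cons x b ih => exact ((ih h.1).addLetter h.2).1

theorem HighestWeight.codes_injective {b b' : List Letter} (h : HighestWeight b)
    (h' : HighestWeight b') (hl : b.length = b'.length) (hc : codes b = codes b') : b = b' := by
  induction b generalizing b' with
  | nil => exact (List.length_eq_zero_iff.1 hl.symm).symm
  | cons x b ih =>
    cases b' with
    | nil => simp at hl
    | cons y b' =>
      have hl' : b.length = b'.length := by simpa using hl
      have e := (h.1.isPair.addLetter h.2).2
      have e' := (h'.1.isPair.addLetter h'.2).2
      simp only [codes] at hc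
      rw [hc, hl', e'] at e
      simp only [Prod.mk.injEq] at e
      rw [e.1, ih h.1 h'.1 hl' e.2.symm]

theorem IsPair.exists_highestWeight {k : ℕ} {p : Code × Code} (h : IsPair k p) :
    ∃ b, HighestWeight b ∧ b.length = k ∧ codes b = p := by
  induction k generalizing p with
  | zero =>
    refine ⟨[], trivial, rfl, ?_⟩
    obtain ⟨G, F⟩ := p
    have hm := h.mem
    cases G with
    | cons q G => have := (hm q.1).1 (by simp); omega
    | nil =>
      cases F with
      | cons q F => have := (hm q.1).1 (by simp); omega
      | nil => rfl
  | succ k ih =>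
    obtain ⟨h1, h2, h3⟩ := h.dropLetter
    obtain ⟨b, hb, rfl, hp⟩ := ih h1
    refine ⟨(DDF.dropLetter (b.length + 1) p).1 :: b, ⟨hb, by rwa [hp]⟩, rfl, ?_⟩
    rw [codes, hp, h3]

theorem altSum_codes (b : List Letter) : altSum (codes b).2 = b.count .empty := by
  induction b with
  | nil => simp [codes, altSum]
  | cons x b ih =>
    rw [codes, altSum_addLetter, ih, List.count_cons]
    simp

theorem HighestWeight.length_le {b : List Letter} (h : HighestWeight b) :
    (codes b).1.length ≤ b.length := by
  have hp := h.isPair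
  have : (letters (codes b).1).toFinset ⊆ Finset.Icc 1 b.length := by
    intro x hx
    rw [List.mem_toFinset] at hx
    exact Finset.mem_Icc.2 ((hp.mem x).1 (Or.inl hx))
  have := Finset.card_le_card this
  rwa [List.toFinset_card_of_nodup hp.fst.nodup, Nat.card_Icc, List.length_map,
    Nat.add_sub_cancel] at this

theorem HighestWeight.wt_eq {b : List Letter} (h : HighestWeight b) (s : ℕ) :
    wt b s = cnt s (codes b).1 := by
  induction b with
  | nil => simp [wt, codes]
  | cons x b ih =>
    have := ih h.1
    have hx := h.2
    simp only [wt, List.count_cons] at this ⊢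
    cases x with
    | bar r =>
      have h1 := cnt_ins s (del r (codes b).1).2 (del r (codes b).1).1
      rw [(ins_del h.1.isPair.fst hx).2.2] at h1
      simp only [codes, addLetter] at h1 ⊢
      rw [h1] at this
      by_cases hrs : r = s <;> simp [hrs] at this ⊢ <;> omega
    | plain r =>
      simp only [codes, addLetter, cnt_cons]
      by_cases hrs : r = s <;> simp [hrs] at this ⊢ <;> omega
    | empty => simpa [codes, addLetter] using this
    | zero => exact hx.elim

/-! ### Highest weight words -/

/-- The pairing of the weight of a word with the coroot of the node `i`. -/
theorem phiWord_sub_epsWord {d : Diamond} {n i : ℕ} {b : List Letter}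
    (hb : ∀ x ∈ b, InB d n x) : (phiWord d n i b : ℤ) - epsWord d n i b =
      if i + 1 = n then stringLen d n i * wt b i else wt b i - wt b (i + 1) := by
  induction b with
  | nil => simp [phiWord, epsWord, wt]
  | cons x b ih =>
    have h1 := ih fun y hy => hb y (List.mem_cons_of_mem _ hy)
    have hx := hb x (by simp)
    have h2 : (phi d n i x : ℤ) - eps d n i x = if i + 1 = n then
        stringLen d n i * wt [x] i else wt [x] i - wt [x] (i + 1) := by
      cases x with
      | plain r =>
        simp only [InB] at hx
        simp only [phi, eps, wt, stringLen]
        by_cases e1 : r = i <;> by_cases e2 : r = i + 1 <;> by_cases e3 : i + 1 = n <;>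
          simp [e1, e2, e3] <;> omega
      | bar r =>
        simp only [InB] at hx
        simp only [phi, eps, wt, stringLen]
        by_cases e1 : r = i <;> by_cases e2 : r = i + 1 <;> by_cases e3 : i + 1 = n <;>
          simp [e1, e2, e3] <;> omega
      | zero => simp [phi, eps, wt]
      | empty => simp [phi, eps, wt]
    have h3 : ∀ s, wt (x :: b) s = wt [x] s + wt b s := by
      intro s
      simp only [wt, List.count_cons, List.count_nil]
      push_cast
      ring
    simp only [phiWord, epsWord, h3]
    split_ifs at * with hin
    · rw [mul_add, ← h1, ← h2]
      omega
    · omega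

/-- For words of length at most `n`, the highest weight condition can be checked letter by letter.
The bound on the length makes the `n`-th coordinate of the weight zero before the last letter, which
excludes the letters `0` and barred `n`. -/
theorem highestWeight_iff {d : Diamond} {n : ℕ} {b : List Letter} (hb : ∀ x ∈ b, InB d n x)
    (hl : b.length ≤ n) : (∀ i < nodes n d, epsWord d n i b = 0) ↔ HighestWeight b := by
  induction b with
  | nil => simp [epsWord, HighestWeight]
  | cons x b ih =>
    have hb' : ∀ y ∈ b, InB d n y := fun y hy => hb y (List.mem_cons_of_mem _ hy)
    have hx := hb x (by simp)
    rw [List.length_cons] at hl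
    have h1 := ih hb' (by omega)
    have h2 : (∀ i < nodes n d, epsWord d n i (x :: b) = 0) ↔
        (∀ i < nodes n d, epsWord d n i b = 0) ∧
          ∀ i < nodes n d, eps d n i x ≤ phiWord d n i b := by
      simp only [epsWord, Nat.add_eq_zero_iff, Nat.sub_eq_zero_iff_le]
      exact ⟨fun h => ⟨fun i hi => (h i hi).1, fun i hi => (h i hi).2⟩,
        fun h i hi => ⟨h.1 i hi, h.2 i hi⟩⟩
    rw [h2, HighestWeight, h1]
    refine and_congr_right fun hg => ?_
    have hphi : ∀ i < nodes n d, (phiWord d n i b : ℤ) = if i + 1 = n then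
        stringLen d n i * (cnt i (codes b).1 : ℤ) else
        (cnt i (codes b).1 : ℤ) - cnt (i + 1) (codes b).1 := by
      intro i hi
      have := phiWord_sub_epsWord (i := i) hb'
      rw [h1.2 hg i hi, hg.wt_eq, hg.wt_eq] at this
      simpa using this
    have hzero : ∀ s, n ≤ s + 1 → cnt s (codes b).1 = 0 := by
      intro s hs
      by_contra h0
      have := hg.isPair.fst.yam.lt_length (Nat.pos_of_ne_zero h0)
      have := hg.length_le
      omega
    cases x with
    | plain r =>
      simp only [Fits, eps]
      simp only [InB] at hx
      constructor
      · rintro h s rfl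
        have hs : s < nodes n d := by cases d <;> simp only [nodes] <;> omega
        have := h s hs
        have h4 := hphi s hs
        rw [if_neg (by omega)] at h4
        simp at this
        omega
      · intro h i hi
        split_ifs with hr
        · have := h i hr
          have h4 := hphi i hi
          rw [if_neg (by omega)] at h4
          omega
        · omega
    | bar r =>
      simp only [Fits, eps]
      simp only [InB] at hx
      have hr : r < nodes n d := by cases d <;> simp_all [nodes]
      have h4 := hphi r hr
      have h5 : 1 ≤ stringLen d n r := by simp only [stringLen]; split_ifs <;> omega
      constructor
      · intro h
        have := h r hr
        rw [if_pos rfl] at this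
        by_cases hn : r + 1 = n
        · rw [if_pos hn, hzero r (by omega)] at h4
          simp at h4
          omega
        · rw [if_neg hn] at h4
          omega
      · intro h i hi
        split_ifs with hri
        · subst hri
          have hn : r + 1 ≠ n := by
            intro hn
            have := hzero r (by omega)
            omega
          have h6 : stringLen d n r = 1 := by simp [stringLen, hn]
          rw [if_neg hn] at h4
          omega
        · omega
    | zero =>
      simp only [Fits, iff_false, eps]
      intro h
      simp only [InB] at hx
      subst hx
      have hn : n - 1 < nodes n .box := by simp only [nodes]; omega
      have := h (n - 1) hn
      have h4 := hphi (n - 1) hn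
      rw [hzero (n - 1) (by omega)] at h4
      rw [if_pos (by omega)] at this h4
      simp at h4
      omega
    | empty => simp [Fits, eps]

theorem HighestWeight.lt_length {b : List Letter} (h : HighestWeight b) {x : Letter}
    (hx : x ∈ b) {r : ℕ} (hr : x = .plain r ∨ x = .bar r) : r < b.length := by
  induction b with
  | nil => simp at hx
  | cons y b ih =>
    rcases List.mem_cons.1 hx with rfl | hx
    · have hlen := h.1.length_le
      have hy := h.1.isPair.fst.yam
      have h2 := h.2
      rcases hr with rfl | rfl
      · cases r with
        | zero => simp
        | succ s =>
          have := hy.lt_length (s := s) (by have := h2 s rfl; omega)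
          simp; omega
      · have := hy.lt_length (s := r) (by simp only [Fits] at h2; omega)
        simp; omega
    · have := ih h.1 hx
      simp; omega

theorem HighestWeight.zero_notMem {b : List Letter} (h : HighestWeight b) : Letter.zero ∉ b := by
  induction b with
  | nil => simp
  | cons y b ih =>
    rw [List.mem_cons, not_or]
    refine ⟨?_, ih h.1⟩
    rintro rfl
    exact h.2

/-! ### Fillings and their entries -/

/-- The entry in row `i` and column `j`, if this cell exists. -/
def entry (T : Filling) (i j : ℕ) : Option ℕ := (T.getD i [])[j]?

/-- Rows and columns form a diagram and increase strictly. In contrast to `IsTableau`, this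
description is symmetric under transposition and does not mention the shape. -/
structure Valid (T : Filling) : Prop where
  ne_nil : ∀ R ∈ T, R ≠ []
  row : ∀ i j y, entry T i (j + 1) = some y → ∃ x < y, entry T i j = some x
  col : ∀ i j y, entry T (i + 1) j = some y → ∃ x < y, entry T i j = some x

theorem filling_ext {T T' : Filling} (h : ∀ R ∈ T, R ≠ []) (h' : ∀ R ∈ T', R ≠ [])
    (he : ∀ i j, entry T i j = entry T' i j) : T = T' := by
  have hrow : ∀ i, T.getD i [] = T'.getD i [] := fun i => List.ext_getElem? (he i)
  clear he
  induction T generalizing T' with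
  | nil =>
    cases T' with
    | nil => rfl
    | cons R' T' => exact absurd (hrow 0).symm (h' R' (by simp))
  | cons R T ih =>
    cases T' with
    | nil => exact absurd (hrow 0) (h R (by simp))
    | cons R' T' =>
      have h0 : R = R' := hrow 0
      rw [h0, ih (fun R hR => h R (List.mem_cons_of_mem _ hR))
        (fun R hR => h' R (List.mem_cons_of_mem _ hR)) fun i => hrow (i + 1)]

theorem exists_entry_of_mem {T : Filling} {R : List ℕ} (hR : R ∈ T) :
    ∃ i, T.getD i [] = R := by
  obtain ⟨i, hi, rfl⟩ := List.mem_iff_getElem.1 hR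
  exact ⟨i, by simp [List.getD_eq_getElem?_getD, hi]⟩

theorem getD_mem {T : Filling} {i : ℕ} (h : T.getD i [] ≠ []) : T.getD i [] ∈ T := by
  by_cases hi : i < T.length
  · simp [List.getD_eq_getElem?_getD, hi]
  · simp [List.getD_eq_getElem?_getD, not_lt.1 hi] at h

theorem mem_of_entry {T : Filling} {i j y : ℕ} (h : entry T i j = some y) : y ∈ T.flatten := by
  have hy : y ∈ T.getD i [] := List.mem_of_getElem? h
  exact List.mem_flatten.2 ⟨_, getD_mem (List.ne_nil_of_mem hy), hy⟩

theorem Valid.row_sorted {T : Filling} (h : Valid T) {R : List ℕ} (hR : R ∈ T) :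
    R.Pairwise (· < ·) := by
  obtain ⟨i, rfl⟩ := exists_entry_of_mem hR
  rw [← List.isChain_iff_pairwise, List.isChain_iff_getElem]
  intro j hj
  obtain ⟨x, hx, he⟩ := h.row i j _ (List.getElem?_eq_getElem hj)
  rw [entry, List.getElem?_eq_getElem (by omega)] at he
  simp only [Option.some.injEq] at he
  omega

theorem Valid.tail {R : List ℕ} {T : Filling} (h : Valid (R :: T)) : Valid T :=
  ⟨fun R hR => h.ne_nil R (List.mem_cons_of_mem _ hR), fun i => h.row (i + 1),
    fun i => h.col (i + 1)⟩

theorem Valid.length_le {T : Filling} (h : Valid T) (i : ℕ) :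
    (T.getD (i + 1) []).length ≤ (T.getD i []).length := by
  by_contra hlt
  rw [not_le] at hlt
  obtain ⟨x, -, hx⟩ := h.col i _ _ (List.getElem?_eq_getElem hlt)
  simp [entry] at hx

theorem Valid.antitone {T : Filling} (h : Valid T) :
    Antitone fun i => (T.getD i []).length :=
  antitone_nat_of_succ_le h.length_le

/-! ### Transposition -/

/-- If column `i` has no gaps, then collecting its entries keeps their row indices. -/
theorem getElem?_filterMap {T : Filling} {i : ℕ}
    (h : ∀ j y, entry T (j + 1) i = some y → ∃ x, entry T j i = some x) (j : ℕ) :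
    (T.filterMap fun R => R[i]?)[j]? = entry T j i := by
  induction T generalizing j with
  | nil => simp [entry]
  | cons R T ih =>
    have h2 := ih fun j => h (j + 1)
    cases hR : R[i]? with
    | some y =>
      rw [List.filterMap_cons_some (f := fun R : List ℕ => R[i]?) hR]
      cases j with
      | zero => simpa [entry] using hR.symm
      | succ j => exact h2 j
    | none =>
      have hnone : ∀ j, entry (R :: T) j i = none := by
        intro j
        induction j with
        | zero => exact hR
        | succ j ihj =>
          by_contra hc
          obtain ⟨y, hy⟩ := Option.ne_none_iff_exists'.1 hc
          obtain ⟨x, hx⟩ := h j y hy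
          rw [ihj] at hx
          simp at hx
      rw [List.filterMap_cons_none (f := fun R : List ℕ => R[i]?) hR, h2 j, hnone j]
      exact hnone (j + 1)

theorem Valid.getElem?_filterMap {T : Filling} (h : Valid T) (i j : ℕ) :
    (T.filterMap fun R => R[i]?)[j]? = entry T j i :=
  DDF.getElem?_filterMap (fun j y hy => (h.col j i y hy).imp fun _ hx => hx.2) j

theorem Valid.entry_transpose {T : Filling} (h : Valid T) (i j : ℕ) :
    entry (transpose T) i j = entry T j i := by
  rw [entry, transpose, List.getD_eq_getElem?_getD]
  by_cases hi : i < (T.headD []).length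
  · rw [List.getElem?_map, List.getElem?_range hi]
    exact h.getElem?_filterMap i j
  · have h1 : (T.getD j []).length ≤ (T.getD 0 []).length := h.antitone (Nat.zero_le j)
    have h2 : T.getD 0 [] = T.headD [] := by cases T <;> rfl
    rw [h2] at h1
    have h3 : (List.range (T.headD []).length)[i]? = none := by
      rw [List.getElem?_eq_none_iff, List.length_range]
      omega
    have h4 : entry T j i = none := List.getElem?_eq_none (by omega)
    rw [List.getElem?_map, h3, h4]
    rfl

theorem Valid.transpose {T : Filling} (h : Valid T) : Valid (transpose T) := by
  refine ⟨fun R hR => ?_, fun i j y => ?_, fun i j y => ?_⟩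
  · simp only [DDF.transpose, List.mem_map, List.mem_range] at hR
    obtain ⟨i, hi, rfl⟩ := hR
    intro hnil
    have := h.getElem?_filterMap i 0
    rw [hnil] at this
    cases T with
    | nil => simp at hi
    | cons R T => simp [entry] at this hi; omega
  · rw [h.entry_transpose, h.entry_transpose]
    exact h.col j i y
  · rw [h.entry_transpose, h.entry_transpose]
    exact h.row j i y

theorem Valid.transpose_transpose {T : Filling} (h : Valid T) :
    DDF.transpose (DDF.transpose T) = T :=
  filling_ext h.transpose.transpose.ne_nil h.ne_nil fun i j => by
    rw [h.transpose.entry_transpose, h.entry_transpose]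

/-! ### Fillings and semistandard tableaux -/

theorem exists_rowLen {f : ℕ → ℕ} (hf : Antitone f) {N : ℕ} (hN : f N = 0) :
    ∃ μ : YoungDiagram, ∀ i, μ.rowLen i = f i := by
  have hmem : ∀ c : ℕ × ℕ, c ∈ ((Finset.range N ×ˢ Finset.range (f 0)).filter
      fun c => c.2 < f c.1) ↔ c.2 < f c.1 := by
    intro c
    simp only [Finset.mem_filter, Finset.mem_product, Finset.mem_range, and_iff_right_iff_imp]
    intro hc
    refine ⟨?_, hc.trans_le (hf (Nat.zero_le _))⟩
    by_contra hle
    have := hf (not_lt.1 hle)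
    omega
  refine ⟨⟨(Finset.range N ×ˢ Finset.range (f 0)).filter fun c => c.2 < f c.1, ?_⟩, fun i => ?_⟩
  · rintro ⟨i, j⟩ ⟨i', j'⟩ ⟨h1, h2⟩ h
    rw [Finset.mem_coe, hmem] at h ⊢
    exact lt_of_le_of_lt h2 (lt_of_lt_of_le h (hf h1))
  · refine eq_of_forall_lt_iff fun j => ?_
    rw [← YoungDiagram.mem_iff_lt_rowLen]
    exact hmem (i, j)

theorem Valid.exists_shape {T : Filling} (h : Valid T) :
    ∃ μ : YoungDiagram, ∀ i, μ.rowLen i = (T.getD i []).length :=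
  exists_rowLen h.antitone (N := T.length) (by simp)

theorem entry_rows {μ : YoungDiagram} (t : SemistandardYoungTableau μ) (i j : ℕ) :
    entry (rows t) i j = if j < μ.rowLen i then some (t i j) else none := by
  rw [entry, rows, List.getD_eq_getElem?_getD]
  by_cases hi : i < μ.colLen 0
  · by_cases hj : j < μ.rowLen i <;> simp [hi, hj]
  · have : μ.rowLen i = 0 := by
      by_contra h0
      exact hi (YoungDiagram.mem_iff_lt_colLen.1
        (YoungDiagram.mem_iff_lt_rowLen.2 (Nat.pos_of_ne_zero h0)))
    simp [hi, this]

theorem rows_ne_nil {μ : YoungDiagram} (t : SemistandardYoungTableau μ) :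
    ∀ R ∈ rows t, R ≠ [] := by
  intro R hR
  simp only [rows, List.mem_map, List.mem_range] at hR
  obtain ⟨i, hi, rfl⟩ := hR
  have := YoungDiagram.mem_iff_lt_rowLen.1 (YoungDiagram.mem_iff_lt_colLen.2 hi)
  simpa [← Nat.pos_iff_ne_zero] using this

theorem IsTableau.length_row {μ : YoungDiagram} {T : Filling} (h : IsTableau μ T) (i : ℕ) :
    (T.getD i []).length = μ.rowLen i := by
  obtain ⟨t, rfl⟩ := h
  refine eq_of_forall_lt_iff fun j => ?_
  rw [← not_iff_not, not_lt, ← List.getElem?_eq_none_iff]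
  have := entry_rows t i j
  rw [entry] at this
  rw [this]
  simp

theorem Valid.isTableau {T : Filling} (h : Valid T) {μ : YoungDiagram}
    (hμ : ∀ i, μ.rowLen i = (T.getD i []).length) : IsTableau μ T := by
  have hmem : ∀ i j, (i, j) ∈ μ ↔ (entry T i j).isSome := by
    intro i j
    simp [YoungDiagram.mem_iff_lt_rowLen, hμ, entry]
  have hrow : ∀ i j k, j < k → (i, k) ∈ μ →
      (entry T i j).getD 0 < (entry T i k).getD 0 := by
    intro i j k hjk hk
    induction k, hjk using Nat.le_induction with
    | base =>
      obtain ⟨y, hy⟩ := Option.isSome_iff_exists.1 ((hmem _ _).1 hk)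
      obtain ⟨x, hx, he⟩ := h.row i j y hy
      rw [hy, he]
      exact hx
    | succ k hjk ih =>
      obtain ⟨y, hy⟩ := Option.isSome_iff_exists.1 ((hmem _ _).1 hk)
      obtain ⟨x, hx, he⟩ := h.row i k y hy
      have := ih ((hmem _ _).2 (by simp [he]))
      rw [hy]
      rw [he] at this
      exact this.trans hx
  have hcol : ∀ i k j, i < k → (k, j) ∈ μ →
      (entry T i j).getD 0 < (entry T k j).getD 0 := by
    intro i k j hik hk
    induction k, hik using Nat.le_induction with
    | base =>
      obtain ⟨y, hy⟩ := Option.isSome_iff_exists.1 ((hmem _ _).1 hk)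
      obtain ⟨x, hx, he⟩ := h.col i j y hy
      rw [hy, he]
      exact hx
    | succ k hik ih =>
      obtain ⟨y, hy⟩ := Option.isSome_iff_exists.1 ((hmem _ _).1 hk)
      obtain ⟨x, hx, he⟩ := h.col k j y hy
      have := ih ((hmem _ _).2 (by simp [he]))
      rw [hy]
      rw [he] at this
      exact this.trans hx
  refine ⟨⟨fun i j => (entry T i j).getD 0, fun h1 h2 => (hrow _ _ _ h1 h2).le,
    fun h1 h2 => hcol _ _ _ h1 h2, fun {i j} hij => ?_⟩, ?_⟩
  · rw [hmem, Option.not_isSome_iff_eq_none] at hij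
    simp [hij]
  · refine filling_ext (rows_ne_nil _) h.ne_nil fun i j => ?_
    rw [entry_rows]
    simp only [← YoungDiagram.mem_iff_lt_rowLen]
    split_ifs with hij
    · obtain ⟨y, hy⟩ := Option.isSome_iff_exists.1 ((hmem _ _).1 hij)
      change some ((entry T i j).getD 0) = _
      rw [hy]
      rfl
    · rw [hmem, Option.not_isSome_iff_eq_none] at hij
      exact hij.symm

/-- A semistandard tableau with distinct letters increases strictly along the rows. -/
theorem IsTableau.valid {μ : YoungDiagram} {T : Filling} (h : IsTableau μ T)
    (hn : T.flatten.Nodup) : Valid T := by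
  obtain ⟨t, rfl⟩ := h
  have hsome : ∀ i j y, entry (rows t) i j = some y → (i, j) ∈ μ ∧ t i j = y := by
    intro i j y hy
    rw [entry_rows] at hy
    simp only [← YoungDiagram.mem_iff_lt_rowLen] at hy
    split_ifs at hy with hij
    exact ⟨hij, by simpa using hy⟩
  have hentry : ∀ i j, (i, j) ∈ μ → entry (rows t) i j = some (t i j) := by
    intro i j hij
    rw [entry_rows, if_pos (YoungDiagram.mem_iff_lt_rowLen.1 hij)]
  refine ⟨rows_ne_nil t, fun i j y hy => ?_, fun i j y hy => ?_⟩
  · obtain ⟨hm, rfl⟩ := hsome _ _ _ hy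
    have hm' : (i, j) ∈ μ := μ.up_left_mem le_rfl (Nat.le_succ j) hm
    refine ⟨t i j, lt_of_le_of_ne (t.row_weak (Nat.lt_succ_self j) hm) fun he => ?_,
      hentry _ _ hm'⟩
    have h1 := hentry _ _ hm'
    have hne : (rows t).getD i [] ≠ [] := by
      intro h0
      rw [entry, h0] at hy
      simp at hy
    have hnd : ((rows t).getD i []).Nodup := (List.nodup_flatten.1 hn).1 _ (getD_mem hne)
    rw [he, ← hy] at h1
    simp only [entry] at h1 hy
    have hlt : j + 1 < ((rows t).getD i []).length := (List.getElem?_eq_some_iff.1 hy).1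
    have := (List.getElem?_inj (by omega) hnd).1 h1
    omega
  · obtain ⟨hm, rfl⟩ := hsome _ _ _ hy
    exact ⟨t i j, t.col_strict (Nat.lt_succ_self i) hm,
      hentry _ _ (μ.up_left_mem (Nat.le_succ i) le_rfl hm)⟩

/-! ### Insertion into fillings -/

/-- Either nothing is bumped, or the first entry `y` with `r x y` is. -/
theorem bump_cases (r : ℕ → ℕ → Prop) [DecidableRel r] (x : ℕ) (R : List ℕ) :
    ((∀ y ∈ R, ¬ r x y) ∧ bump r x R = (R ++ [x], none)) ∨
    ∃ u y v, R = u ++ y :: v ∧ (∀ z ∈ u, ¬ r x z) ∧ r x y ∧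
      bump r x R = (u ++ x :: v, some y) := by
  induction R with
  | nil => exact Or.inl ⟨by simp, rfl⟩
  | cons z R ih =>
    by_cases hz : r x z
    · exact Or.inr ⟨[], z, R, rfl, by simp, hz, by simp [bump, hz]⟩
    · rcases ih with ⟨h1, h2⟩ | ⟨u, y, v, rfl, h1, h2, h3⟩
      · exact Or.inl ⟨by simpa [hz] using h1, by simp [bump, hz, h2]⟩
      · exact Or.inr ⟨z :: u, y, v, rfl, by simpa [hz] using h1, h2, by simp [bump, hz, h3]⟩

theorem bump_of_not {r : ℕ → ℕ → Prop} [DecidableRel r] {x : ℕ} {R : List ℕ}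
    (h : ∀ y ∈ R, ¬ r x y) : bump r x R = (R ++ [x], none) := by
  rcases bump_cases r x R with h1 | ⟨u, y, v, rfl, -, h2, -⟩
  · exact h1.2
  · exact absurd h2 (h y (by simp))

theorem bump_append {r : ℕ → ℕ → Prop} [DecidableRel r] {x y : ℕ} {u v : List ℕ}
    (h : ∀ z ∈ u, ¬ r x z) (hy : r x y) : bump r x (u ++ y :: v) = (u ++ x :: v, some y) := by
  induction u with
  | nil => simp [bump, hy]
  | cons z u ih =>
    rw [List.forall_mem_cons] at h
    simp [bump, h.1, ih h.2]

/-- The row of the new cell of the row insertion of `x`. -/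
def newRow (x : ℕ) : Filling → ℕ
  | [] => 0
  | R :: Rs =>
    match (bump (· < ·) x R).2 with
    | none => 0
    | some y => newRow y Rs + 1

theorem insertLines_cons_none {r : ℕ → ℕ → Prop} [DecidableRel r] {x : ℕ} {R R' : List ℕ}
    {Rs : Filling} (h : bump r x R = (R', none)) : insertLines r x (R :: Rs) = R' :: Rs := by
  rw [insertLines, h]

theorem insertLines_cons_some {r : ℕ → ℕ → Prop} [DecidableRel r] {x y : ℕ} {R R' : List ℕ}
    {Rs : Filling} (h : bump r x R = (R', some y)) :
    insertLines r x (R :: Rs) = R' :: insertLines r y Rs := by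
  rw [insertLines, h]

theorem newRow_cons_none {x : ℕ} {R R' : List ℕ} {Rs : Filling}
    (h : bump (· < ·) x R = (R', none)) : newRow x (R :: Rs) = 0 := by
  rw [newRow, h]

theorem newRow_cons_some {x y : ℕ} {R R' : List ℕ} {Rs : Filling}
    (h : bump (· < ·) x R = (R', some y)) : newRow x (R :: Rs) = newRow y Rs + 1 := by
  rw [newRow, h]

theorem rowInsert_of_lt {T : Filling} {x : ℕ} (h : ∀ y ∈ T.flatten, y < x) :
    rowInsert T x = adjoin x 0 T ∧ newRow x T = 0 := by
  cases T with
  | nil => exact ⟨rfl, rfl⟩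
  | cons R T =>
    have hb : bump (· < ·) x R = (R ++ [x], none) :=
      bump_of_not fun y hy => (h y (by simp [hy])).not_gt
    exact ⟨insertLines_cons_none hb, newRow_cons_none hb⟩

/-- The effect of a row insertion on a letter `m` larger than all the others: it is bumped exactly
if it occupies the new cell of the insertion into the rest of the filling. -/
theorem rowInsert_adjoin {T : Filling} {x m s : ℕ} (hs : s ≤ T.length) (hx : x < m)
    (hm : ∀ y ∈ T.flatten, y < m) :
    rowInsert (adjoin m s T) x = (if s = newRow x T then adjoin m (s + 1) (rowInsert T x)
      else adjoin m s (rowInsert T x)) ∧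
    newRow x (adjoin m s T) = if s = newRow x T then s + 1 else newRow x T := by
  induction T generalizing x s with
  | nil =>
    obtain rfl : s = 0 := by simpa using hs
    simp [adjoin, rowInsert, insertLines, newRow, bump, hx]
  | cons R T ih =>
    have hR : ∀ y ∈ R, y < m := fun y hy => hm y (by simp [hy])
    have hT : ∀ y ∈ T.flatten, y < m := fun y hy => hm y (by simp at hy ⊢; exact Or.inr hy)
    cases s with
    | zero =>
      simp only [adjoin]
      rcases bump_cases (· < ·) x R with ⟨h1, h2⟩ | ⟨u, y, v, rfl, h1, h2, h3⟩
      · have h4 : bump (· < ·) x (R ++ [m]) = (R ++ [x], some m) := bump_append h1 hx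
        have h5 := rowInsert_of_lt hT
        rw [newRow_cons_none h2, newRow_cons_some h4, h5.2]
        simp only [rowInsert] at h5 ⊢
        rw [insertLines_cons_none h2, insertLines_cons_some h4, h5.1]
        simp [adjoin]
      · have h4 : bump (· < ·) x (u ++ y :: v ++ [m]) = (u ++ x :: v ++ [m], some y) := by
          rw [List.append_assoc, List.cons_append, bump_append h1 h2]
          simp
        rw [newRow_cons_some h3, newRow_cons_some h4]
        simp only [rowInsert]
        rw [insertLines_cons_some h3, insertLines_cons_some h4]
        simp [adjoin]
    | succ s =>
      simp only [adjoin]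
      rcases bump_cases (· < ·) x R with ⟨h1, h2⟩ | ⟨u, y, v, rfl, h1, h2, h3⟩
      · rw [newRow_cons_none h2, newRow_cons_none h2]
        simp only [rowInsert]
        rw [insertLines_cons_none h2, insertLines_cons_none h2]
        simp [adjoin]
      · have := ih (x := y) (s := s) (by simpa using hs) (hR y (by simp)) hT
        rw [newRow_cons_some h3, newRow_cons_some h3]
        simp only [rowInsert] at this ⊢
        rw [insertLines_cons_some h3, insertLines_cons_some h3, this.1, this.2]
        by_cases hsy : s = newRow y T <;> simp [hsy, adjoin]

theorem unbump_append {y x : ℕ} {u v : List ℕ} (hu : ∀ z ∈ u, z < y) (hx : x < y)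
    (hv : ∀ z ∈ v, ¬ z < y) : unbump y (u ++ x :: v) = (u ++ y :: v, x) := by
  induction u with
  | nil =>
    cases v with
    | nil => rfl
    | cons z v => simp [unbump, hv z (by simp)]
  | cons a u ih =>
    rw [List.forall_mem_cons] at hu
    have := ih hu.2
    cases u with
    | nil => simp [unbump, hx] at this ⊢; simp [this]
    | cons b u => simp [unbump, hu.2 b (by simp)] at this ⊢; simp [this]

/-- Reverse insertion at the new cell undoes a row insertion. -/
theorem reverseInsert_rowInsert {T : Filling} (x : ℕ) (hne : ∀ R ∈ T, R ≠ [])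
    (hs : ∀ R ∈ T, R.Pairwise (· < ·)) :
    reverseInsert (newRow x T) (rowInsert T x) = (T, x) := by
  induction T generalizing x with
  | nil => rfl
  | cons R T ih =>
    rw [List.forall_mem_cons] at hne hs
    rcases bump_cases (· < ·) x R with ⟨h1, h2⟩ | ⟨u, y, v, rfl, h1, h2, h3⟩
    · rw [newRow_cons_none h2, rowInsert, insertLines_cons_none h2]
      simp [reverseInsert, hne.1]
    · rw [newRow_cons_some h3, rowInsert, insertLines_cons_some h3]
      have := ih y hne.2 hs.2
      rw [rowInsert] at this
      have hp := hs.1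
      rw [List.pairwise_append, List.pairwise_cons] at hp
      have h4 : unbump y (u ++ x :: v) = (u ++ y :: v, x) :=
        unbump_append (fun z hz => hp.2.2 z hz y (by simp)) h2
          fun z hz => (hp.2.1.1 z hz).not_gt
      rw [reverseInsert, this, h4]

/-- For distinct letters the weak and the strict bumping rule agree. -/
theorem insertLines_le {T : Filling} {x : ℕ} (hn : (x :: T.flatten).Nodup) :
    insertLines (· ≤ ·) x T = rowInsert T x := by
  induction T generalizing x with
  | nil => rfl
  | cons R T ih =>
    have hxR : x ∉ R := by simp at hn; tauto
    have hlt : ∀ {y}, y ∈ R → (x ≤ y ↔ x < y) := fun {y} hy => by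
      have : x ≠ y := by rintro rfl; exact hxR hy
      omega
    rw [rowInsert]
    rcases bump_cases (· < ·) x R with ⟨h1, h2⟩ | ⟨u, y, v, rfl, h1, h2, h3⟩
    · rw [insertLines_cons_none h2, insertLines_cons_none]
      exact bump_of_not fun y hy => by rw [hlt hy]; exact h1 y hy
    · have h4 : bump (· ≤ ·) x (u ++ y :: v) = (u ++ x :: v, some y) :=
        bump_append (fun z hz => by rw [hlt (by simp [hz])]; exact h1 z hz) h2.le
      rw [insertLines_cons_some h3, insertLines_cons_some h4, ih, rowInsert]
      have h5 := (List.nodup_cons.1 hn).2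
      simp only [List.flatten_cons, List.append_assoc, List.cons_append] at h5
      have h6 := (List.nodup_append.1 h5).2.1
      exact h6.sublist ((List.sublist_append_right v T.flatten).cons_cons y)

/-! ### The tableau of a code -/

/-- The tableau with a given code. -/
def tab : Code → Filling
  | [] => []
  | p :: F => adjoin p.1 p.2 (tab F)

theorem getD_adjoin {T : Filling} {i s : ℕ} (hs : s ≤ T.length) (t : ℕ) :
    (adjoin i s T).getD t [] = if t = s then T.getD s [] ++ [i] else T.getD t [] := by
  induction T generalizing s t with
  | nil =>
    obtain rfl : s = 0 := by simpa using hs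
    cases t <;> simp [adjoin]
  | cons R T ih =>
    cases s with
    | zero => cases t <;> simp [adjoin]
    | succ s =>
      cases t with
      | zero => simp [adjoin]
      | succ t =>
        have := ih (s := s) (by simpa using hs) t
        simpa [adjoin] using this

theorem adjoin_ne_nil {T : Filling} {i s : ℕ} (h : ∀ R ∈ T, R ≠ []) :
    ∀ R ∈ adjoin i s T, R ≠ [] := by
  induction T generalizing s with
  | nil => cases s <;> simp [adjoin]
  | cons R T ih =>
    rw [List.forall_mem_cons] at h
    cases s with
    | zero => simpa [adjoin] using h.2
    | succ s => simpa [adjoin] using ⟨h.1, ih h.2⟩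

theorem flatten_adjoin {T : Filling} {i s : ℕ} (hs : s ≤ T.length) :
    (adjoin i s T).flatten.Perm (i :: T.flatten) := by
  induction T generalizing s with
  | nil =>
    obtain rfl : s = 0 := by simpa using hs
    simp [adjoin]
  | cons R T ih =>
    cases s with
    | zero => simp [adjoin]
    | succ s =>
      simp only [adjoin, List.flatten_cons]
      exact ((ih (s := s) (by simpa using hs)).append_left R).trans List.perm_middle

theorem Valid.adjoin {T : Filling} (h : Valid T) {i s : ℕ} (hs : s ≤ T.length)
    (hi : ∀ y ∈ T.flatten, y < i)
    (hc : ∀ r, s = r + 1 → (T.getD (r + 1) []).length < (T.getD r []).length) :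
    Valid (adjoin i s T) := by
  have he : ∀ t j, entry (DDF.adjoin i s T) t j =
      if t = s ∧ j = (T.getD s []).length then some i else entry T t j := by
    intro t j
    rw [entry, getD_adjoin hs]
    by_cases ht : t = s
    · subst ht
      simp only [if_true, true_and, List.getElem?_append, entry]
      split_ifs with h1 h2 h2
      · omega
      · rfl
      · simp [h2]
      · rw [List.getElem?_eq_none (by rw [List.length_singleton]; omega),
          List.getElem?_eq_none (by omega)]
    · simp [ht, entry]
  have hold : ∀ t j x, entry T t j = some x → entry (DDF.adjoin i s T) t j = some x := by
    intro t j x hx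
    rw [he, if_neg, hx]
    rintro ⟨rfl, rfl⟩
    simp [entry] at hx
  refine ⟨adjoin_ne_nil h.ne_nil, fun t j y hy => ?_, fun t j y hy => ?_⟩
  · rw [he] at hy
    split_ifs at hy with h1
    · obtain ⟨rfl, h2⟩ := h1
      obtain rfl : i = y := by simpa using hy
      have h3 : entry T t j = some ((T.getD t [])[j]'(by omega)) := List.getElem?_eq_getElem _
      exact ⟨_, hi _ (mem_of_entry h3), hold _ _ _ h3⟩
    · obtain ⟨x, hx, h3⟩ := h.row t j y hy
      exact ⟨x, hx, hold _ _ _ h3⟩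
  · rw [he] at hy
    split_ifs at hy with h1
    · obtain ⟨rfl, h2⟩ := h1
      obtain rfl : i = y := by simpa using hy
      have h4 := hc t rfl
      have h3 : entry T t j = some ((T.getD t [])[j]'(by omega)) := List.getElem?_eq_getElem _
      exact ⟨_, hi _ (mem_of_entry h3), hold _ _ _ h3⟩
    · obtain ⟨x, hx, h3⟩ := h.col t j y hy
      exact ⟨x, hx, hold _ _ _ h3⟩

theorem le_length_of_corner {T : Filling} {s : ℕ}
    (h : ∀ r, s = r + 1 → (T.getD (r + 1) []).length < (T.getD r []).length) : s ≤ T.length := by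
  cases s with
  | zero => omega
  | succ r =>
    have := h r rfl
    by_contra hlt
    rw [List.getD_eq_getElem?_getD, List.getD_eq_getElem?_getD,
      List.getElem?_eq_none (i := r) (by omega)] at this
    simp at this

/-- The basic properties of the tableau of a code. -/
theorem tab_spec {F : Code} (h : IsStd F) : Valid (tab F) ∧
    (∀ s, ((tab F).getD s []).length = cnt s F) ∧ (tab F).flatten.Perm (letters F) := by
  induction F with
  | nil => exact ⟨⟨by simp [tab], by simp [tab, entry], by simp [tab, entry]⟩, by simp [tab],
      by simp [tab]⟩
  | cons p F ih =>
    obtain ⟨h1, h2, h3⟩ := ih h.tail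
    have hc : ∀ r, p.2 = r + 1 →
        ((tab F).getD (r + 1) []).length < ((tab F).getD r []).length := by
      intro r hr
      rw [h2, h2]
      exact h.yam.2 r hr
    have hs := le_length_of_corner hc
    refine ⟨h1.adjoin hs (fun y hy => h.lt_head y (h3.mem_iff.1 hy)) hc, fun s => ?_,
      (flatten_adjoin hs).trans (h3.cons _)⟩
    rw [tab, getD_adjoin hs, cnt_cons, ← h2 s]
    by_cases hps : p.2 = s
    · subst hps; simp
    · simp [hps, Ne.symm hps]

theorem IsStd.le_length {p : ℕ × ℕ} {F : Code} (h : IsStd (p :: F)) : p.2 ≤ (tab F).length := by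
  refine le_length_of_corner fun r hr => ?_
  rw [(tab_spec h.tail).2.1, (tab_spec h.tail).2.1]
  exact h.yam.2 r hr

theorem IsStd.valid {F : Code} (h : IsStd F) : Valid (tab F) := (tab_spec h).1

theorem IsStd.mem_tab {F : Code} (h : IsStd F) {x : ℕ} : x ∈ (tab F).flatten ↔ x ∈ letters F :=
  (tab_spec h).2.2.mem_iff

theorem IsStd.nodup_tab {F : Code} (h : IsStd F) : (tab F).flatten.Nodup :=
  (tab_spec h).2.2.nodup_iff.2 h.nodup

/-- The rows of the tableau of a code can be read off from the code. -/
theorem mem_getD_tab {F : Code} (h : IsStd F) {i s : ℕ} :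
    i ∈ (tab F).getD s [] ↔ (i, s) ∈ F := by
  induction F with
  | nil => simp [tab]
  | cons p F ih =>
    rw [tab, getD_adjoin h.le_length, List.mem_cons, ← ih h.tail, Prod.ext_iff]
    by_cases hps : s = p.2
    · subst hps; simp [or_comm]
    · simp [hps]

theorem tab_injective {F F' : Code} (h : IsStd F) (h' : IsStd F') (he : tab F = tab F') :
    F = F' := by
  have hm : ∀ p, p ∈ F ↔ p ∈ F' := fun p => by
    rw [← mem_getD_tab h, ← mem_getD_tab h', he]
  have hs : F.Pairwise fun p q => p.1 > q.1 := List.pairwise_map.1 h.sorted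
  have hs' : F'.Pairwise fun p q => p.1 > q.1 := List.pairwise_map.1 h'.sorted
  have hn : F.Nodup := List.Nodup.of_map _ h.nodup
  have hn' : F'.Nodup := List.Nodup.of_map _ h'.nodup
  exact ((List.perm_ext_iff_of_nodup hn hn').2 hm).eq_of_pairwise
    (fun a b _ _ h1 h2 => by omega) hs hs'

/-- Row insertion of codes is row insertion of tableaux. -/
theorem rowInsert_tab {F : Code} (h : IsStd F) {x : ℕ} (hx : x ∉ letters F) :
    rowInsert (tab F) x = tab (ins x F).1 ∧ newRow x (tab F) = (ins x F).2 := by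
  induction F with
  | nil => exact ⟨rfl, rfl⟩
  | cons p F ih =>
    obtain ⟨j, s⟩ := p
    have hlt := h.lt_head
    by_cases hj : j < x
    · have h1 : ∀ y ∈ (tab ((j, s) :: F)).flatten, y < x := by
        intro y hy
        rcases List.mem_cons.1 (h.mem_tab.1 hy) with rfl | hy
        · exact hj
        · exact (hlt y hy).trans hj
      rw [ins, if_pos hj]
      exact rowInsert_of_lt h1
    · have hxj : x < j := by
        have : x ≠ j := by rintro rfl; simp at hx
        omega
      obtain ⟨h1, h2⟩ := ih h.tail fun hm => hx (List.mem_cons_of_mem _ hm)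
      obtain ⟨h3, h4⟩ := rowInsert_adjoin (x := x) (m := j) h.le_length hxj
        fun y hy => hlt y (h.tail.mem_tab.1 hy)
      rw [ins_cons_of_le hxj.le, tab, h3, h4, h1, h2]
      dsimp only
      split_ifs <;> exact ⟨rfl, rfl⟩

theorem reverseInsert_tab {F : Code} (h : IsStd F) {r : ℕ} (hr : cnt (r + 1) F < cnt r F) :
    reverseInsert r (tab F) = (tab (del r F).1, (del r F).2) := by
  obtain ⟨h1, h2, h3⟩ := ins_del h hr
  obtain ⟨h4, h5⟩ := rowInsert_tab h1 h2
  have h6 := reverseInsert_rowInsert (del r F).2 h1.valid.ne_nil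
    fun R hR => h1.valid.row_sorted hR
  rwa [h4, h5, h3] at h6

/-- Insertion of a word into a code. -/
def insWord (F : Code) (w : List ℕ) : Code := w.foldl (fun F x => (ins x F).1) F

theorem insWord_spec {F : Code} (h : IsStd F) {w : List ℕ} (hw : (letters F ++ w).Nodup) :
    w.foldl rowInsert (tab F) = tab (insWord F w) ∧ IsStd (insWord F w) ∧
      (letters (insWord F w)).Perm (letters F ++ w) := by
  induction w generalizing F with
  | nil => exact ⟨rfl, h, by simp [insWord]⟩
  | cons x w ih =>
    have hp : (letters (ins x F).1 ++ w).Perm (letters F ++ x :: w) :=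
      ((letters_ins x F).append_right w).trans List.perm_middle.symm
    have hx : x ∉ letters F := fun hm => by
      rw [List.nodup_append] at hw
      exact hw.2.2 x hm x (by simp) rfl
    obtain ⟨h1, h2, h3⟩ := ih (h.ins hx) (hp.nodup_iff.2 hw)
    refine ⟨?_, h2, h3.trans hp⟩
    rw [List.foldl_cons, (rowInsert_tab h hx).1, h1]
    rfl

/-- For distinct letters, column insertion is row insertion into the transpose. -/
theorem colInsert_transpose_tab {F : Code} (h : IsStd F) {x : ℕ} (hx : x ∉ letters F) :
    colInsert x (transpose (tab F)) = transpose (tab (ins x F).1) := by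
  rw [colInsert, h.valid.transpose_transpose, insertLines_le, (rowInsert_tab h hx).1]
  exact List.nodup_cons.2 ⟨fun hm => hx (h.mem_tab.1 hm), h.nodup_tab⟩

/-! ### Knuth equivalence -/

theorem KnuthEquiv.refl (w : List ℕ) : KnuthEquiv w w := Relation.EqvGen.refl w

theorem KnuthEquiv.symm {w w' : List ℕ} (h : KnuthEquiv w w') : KnuthEquiv w' w :=
  Relation.EqvGen.symm _ _ h

theorem KnuthEquiv.trans {w w' w'' : List ℕ} (h : KnuthEquiv w w') (h' : KnuthEquiv w' w'') :
    KnuthEquiv w w'' := Relation.EqvGen.trans _ _ _ h h'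

theorem KnuthEquiv.append {w w' : List ℕ} (h : KnuthEquiv w w') (a b : List ℕ) :
    KnuthEquiv (a ++ w ++ b) (a ++ w' ++ b) := by
  induction h with
  | rel w w' h =>
    apply Relation.EqvGen.rel
    cases h with
    | xzy u v x y z h1 h2 => simpa using KnuthStep.xzy (a ++ u) (v ++ b) x y z h1 h2
    | yxz u v x y z h1 h2 => simpa using KnuthStep.yxz (a ++ u) (v ++ b) x y z h1 h2
  | refl => exact .refl _
  | symm _ _ _ ih => exact ih.symm
  | trans _ _ _ _ _ ih1 ih2 => exact ih1.trans ih2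

theorem KnuthEquiv.append_left {w w' : List ℕ} (h : KnuthEquiv w w') (a : List ℕ) :
    KnuthEquiv (a ++ w) (a ++ w') := by simpa using h.append a []

theorem KnuthEquiv.append_right {w w' : List ℕ} (h : KnuthEquiv w w') (b : List ℕ) :
    KnuthEquiv (w ++ b) (w' ++ b) := by simpa using h.append [] b

theorem KnuthEquiv.cons {w w' : List ℕ} (h : KnuthEquiv w w') (a : ℕ) :
    KnuthEquiv (a :: w) (a :: w') := h.append_left [a]

theorem knuthEquiv_xzy {x y z : ℕ} (h1 : x ≤ y) (h2 : y < z) (v : List ℕ) :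
    KnuthEquiv (x :: z :: y :: v) (z :: x :: y :: v) :=
  .rel _ _ (KnuthStep.xzy [] v x y z h1 h2)

theorem knuthEquiv_yxz {x y z : ℕ} (h1 : x < y) (h2 : y ≤ z) (v : List ℕ) :
    KnuthEquiv (y :: x :: z :: v) (y :: z :: x :: v) :=
  .rel _ _ (KnuthStep.yxz [] v x y z h1 h2)

theorem KnuthStep.perm {w w' : List ℕ} (h : KnuthStep w w') : w.Perm w' := by
  cases h with
  | xzy u v x y z => exact ((List.Perm.swap z x [y]).append_left u).append_right v
  | yxz u v x y z => exact (((List.Perm.swap z x []).cons y).append_left u).append_right v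

/-- Reversal preserves Knuth equivalence of words with distinct letters. -/
theorem KnuthEquiv.reverse {w w' : List ℕ} (h : KnuthEquiv w w') :
    w.Perm w' ∧ (w.Nodup → KnuthEquiv w.reverse w'.reverse) := by
  induction h with
  | rel w w' h =>
    refine ⟨h.perm, fun hn => ?_⟩
    cases h with
    | xzy u v x y z h1 h2 =>
      have hxy : x ≠ y := by
        rintro rfl
        simp [List.nodup_append] at hn
      have := ((knuthEquiv_yxz (lt_of_le_of_ne h1 hxy) h2.le []).symm).append v.reverse u.reverse
      simpa using this
    | yxz u v x y z h1 h2 =>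
      have hyz : y ≠ z := by
        rintro rfl
        simp [List.nodup_append] at hn
      have := ((knuthEquiv_xzy h1.le (lt_of_le_of_ne h2 hyz) []).symm).append v.reverse u.reverse
      simpa using this
  | refl => exact ⟨.refl _, fun _ => .refl _⟩
  | symm _ _ _ ih => exact ⟨ih.1.symm, fun hn => (ih.2 (ih.1.nodup_iff.2 hn)).symm⟩
  | trans _ _ _ _ _ ih1 ih2 =>
    exact ⟨ih1.1.trans ih2.1, fun hn => (ih1.2 hn).trans (ih2.2 (ih1.1.nodup_iff.1 hn))⟩

/-- Insertion does not distinguish between Knuth equivalent words with distinct letters. -/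
theorem KnuthEquiv.insWord_eq {w w' : List ℕ} (h : KnuthEquiv w w') (F : Code) :
    w.Nodup → insWord F w = insWord F w' := by
  induction h with
  | rel w w' h =>
    intro hn
    cases h with
    | xzy u v x y z h1 h2 =>
      have hxy : x ≠ y := by
        rintro rfl
        simp [List.nodup_append] at hn
      have := (ins₃_xzy (lt_of_le_of_ne h1 hxy) h2 (insWord F u)).2
      simp only [ins₃, insWord] at this
      simp only [insWord, List.foldl_append, List.foldl_cons, List.foldl_nil, this]
    | yxz u v x y z h1 h2 =>
      have hyz : y ≠ z := by
        rintro rfl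
        simp [List.nodup_append] at hn
      have := (ins₃_yzx h1 (lt_of_le_of_ne h2 hyz) (insWord F u)).2
      simp only [ins₃, insWord] at this
      simp only [insWord, List.foldl_append, List.foldl_cons, List.foldl_nil, this]
  | refl => exact fun _ => rfl
  | symm _ _ h ih => exact fun hn => (ih ((KnuthEquiv.reverse h).1.nodup_iff.2 hn)).symm
  | trans _ _ _ h1 _ ih1 ih2 =>
    exact fun hn => (ih1 hn).trans (ih2 ((KnuthEquiv.reverse h1).1.nodup_iff.1 hn))

/-- The letter `x` moves to the left past a weakly increasing word `v`, if in front of `v` there is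
a letter that is larger than `x` and at most the first letter of `v`. -/
theorem knuthEquiv_cons_append {x y : ℕ} {v : List ℕ} (hv : (y :: v).Pairwise (· ≤ ·))
    (hxy : x < y) (w : List ℕ) : KnuthEquiv (y :: (v ++ x :: w)) (y :: x :: (v ++ w)) := by
  induction v generalizing y with
  | nil => exact .refl _
  | cons z v ih =>
    rw [List.pairwise_cons] at hv
    have hyz : y ≤ z := hv.1 z (by simp)
    exact ((ih hv.2 (hxy.trans_le hyz)).cons y).trans (knuthEquiv_yxz hxy hyz _).symm

/-- A letter moves to the left past a weakly increasing word that is followed by a smaller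
letter. -/
theorem knuthEquiv_append_cons {x y : ℕ} {u : List ℕ} (hu : (u ++ [x]).Pairwise (· ≤ ·))
    (hxy : x < y) (v : List ℕ) : KnuthEquiv (u ++ y :: x :: v) (y :: (u ++ x :: v)) := by
  induction u with
  | nil => exact .refl _
  | cons a u ih =>
    rw [List.cons_append, List.pairwise_cons] at hu
    refine ((ih hu.2).cons a).trans ?_
    cases u with
    | nil => exact knuthEquiv_xzy (hu.1 x (by simp)) hxy _
    | cons b u =>
      refine knuthEquiv_xzy (hu.1 b (by simp)) (lt_of_le_of_lt ?_ hxy) _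
      have := (List.pairwise_cons.1 hu.2).1 x (by simp)
      exact this

theorem rowWord_cons (R : List ℕ) (T : Filling) : rowWord (R :: T) = rowWord T ++ R := by
  simp [rowWord]

theorem rowWord_perm (T : Filling) : (rowWord T).Perm T.flatten := by
  exact (List.reverse_perm T).flatten

/-- `T ← x` is Knuth equivalent to `T · x`. -/
theorem rowWord_rowInsert {T : Filling} (hT : ∀ R ∈ T, R.Pairwise (· ≤ ·)) (x : ℕ) :
    KnuthEquiv (rowWord (rowInsert T x)) (rowWord T ++ [x]) := by
  induction T generalizing x with
  | nil => exact .refl _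
  | cons R T ih =>
    rw [List.forall_mem_cons] at hT
    rcases bump_cases (· < ·) x R with ⟨h1, h2⟩ | ⟨u, y, v, rfl, h1, h2, h3⟩
    · rw [rowInsert, insertLines_cons_none h2, rowWord_cons, rowWord_cons, List.append_assoc]
      exact .refl _
    · rw [rowInsert, insertLines_cons_some h3, rowWord_cons, rowWord_cons]
      have hp := hT.1
      rw [List.pairwise_append, List.pairwise_cons] at hp
      have h4 := (ih hT.2 y).append_right (u ++ x :: v)
      refine h4.trans ?_
      simp only [List.append_assoc, List.cons_append, List.nil_append]
      refine KnuthEquiv.append_left ?_ _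
      have hu : (u ++ [x]).Pairwise (· ≤ ·) := by
        rw [List.pairwise_append]
        exact ⟨hp.1, by simp, fun a ha b hb => by
          rw [List.mem_singleton] at hb
          subst hb
          exact not_lt.1 (h1 a ha)⟩
      refine (knuthEquiv_append_cons hu h2 v).symm.trans ?_
      have := (knuthEquiv_cons_append (List.pairwise_cons.2 hp.2.1) h2 []).symm.append_left u
      simpa using this

theorem rowWord_foldl_rowInsert {F : Code} (h : IsStd F) {w : List ℕ}
    (hw : (letters F ++ w).Nodup) :
    KnuthEquiv (rowWord (w.foldl rowInsert (tab F))) (rowWord (tab F) ++ w) := by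
  induction w generalizing F with
  | nil => simp [KnuthEquiv.refl]
  | cons x w ih =>
    have hp : (letters (ins x F).1 ++ w).Perm (letters F ++ x :: w) :=
      ((letters_ins x F).append_right w).trans List.perm_middle.symm
    have hx : x ∉ letters F := fun hm => by
      rw [List.nodup_append] at hw
      exact hw.2.2 x hm x (by simp) rfl
    have h1 := ih (h.ins hx) (hp.nodup_iff.2 hw)
    have h2 := (rowWord_rowInsert
      (fun R hR => (h.valid.row_sorted hR).imp le_of_lt) x).append_right w
    rw [List.foldl_cons, (rowInsert_tab h hx).1]
    refine h1.trans ?_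
    rw [← (rowInsert_tab h hx).1]
    simpa using h2

/-- A decreasing word moves to the left past a weakly increasing word. -/
theorem knuthEquiv_cons_append_append {y : ℕ} {v w : List ℕ} (hv : (y :: v).Pairwise (· ≤ ·))
    (hw : (y :: w).Pairwise (· > ·)) (a : List ℕ) :
    KnuthEquiv (y :: (v ++ (w ++ a))) (y :: (w ++ (v ++ a))) := by
  induction w generalizing y with
  | nil => exact .refl _
  | cons x w ih =>
    rw [List.pairwise_cons] at hw
    have hxy : x < y := hw.1 x (by simp)
    refine (knuthEquiv_cons_append hv hxy _).trans ((ih ?_ hw.2).cons y)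
    rw [List.pairwise_cons] at hv ⊢
    exact ⟨fun z hz => hxy.le.trans (hv.1 z hz), hv.2⟩

/-- The tops of the columns, read from right to left, can be moved to the front. -/
theorem knuthEquiv_flatMap {l : List (ℕ × List ℕ)} (h : (l.map Prod.fst).Pairwise (· > ·))
    (hl : ∀ p ∈ l, (p.1 :: p.2).Pairwise (· ≤ ·)) :
    KnuthEquiv (l.flatMap fun p => p.1 :: p.2) (l.map Prod.fst ++ l.flatMap Prod.snd) := by
  induction l with
  | nil => exact .refl _
  | cons p l ih =>
    rw [List.forall_mem_cons] at hl
    have h' := h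
    rw [List.map_cons, List.pairwise_cons] at h'
    have h1 := (ih h'.2 hl.2).append_left (p.1 :: p.2)
    simp only [List.flatMap_cons, List.map_cons, List.cons_append] at h1 ⊢
    exact h1.trans (knuthEquiv_cons_append_append hl.1 h _)

/-- The first `k` columns, read from right to left. -/
def colsWord (k : ℕ) (T : Filling) : List ℕ :=
  (List.range k).reverse.flatMap fun j => T.filterMap fun R => R[j]?

theorem rowWord_transpose (T : Filling) :
    rowWord (transpose T) = colsWord (T.headD []).length T := by
  rw [rowWord, transpose, colsWord, ← List.map_reverse, List.flatMap_def]

/-- Columns outside of the diagram do not contribute. -/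
theorem colsWord_eq {T : Filling} (h : Valid T) {k : ℕ} (hk : (T.headD []).length ≤ k) :
    colsWord k T = colsWord (T.headD []).length T := by
  induction k, hk using Nat.le_induction with
  | base => rfl
  | succ k hk ih =>
    rw [← ih, colsWord, List.range_succ, List.reverse_append, List.reverse_singleton,
      List.singleton_append, List.flatMap_cons]
    have : (T.filterMap fun R => R[k]?) = [] := by
      rw [List.filterMap_eq_nil_iff]
      intro R hR
      obtain ⟨i, rfl⟩ := exists_entry_of_mem hR
      have h1 : (T.getD i []).length ≤ (T.getD 0 []).length := h.antitone (Nat.zero_le i)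
      have h2 : T.getD 0 [] = T.headD [] := by cases T <;> rfl
      rw [h2] at h1
      exact List.getElem?_eq_none (by omega)
    rw [this]
    rfl

/-- The row word of the transpose of a standard tableau is Knuth equivalent to the reversed row
word. -/
theorem rowWord_transpose_equiv {T : Filling} (h : Valid T) :
    KnuthEquiv (rowWord (transpose T)) (rowWord T).reverse := by
  rw [rowWord_transpose]
  induction T with
  | nil => exact .refl _
  | cons R T ih =>
    have hlen : (T.headD []).length ≤ R.length := by
      have := h.length_le 0
      cases T with
      | nil => simp
      | cons D T => simpa using this
    have h1 := ih h.tail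
    rw [← colsWord_eq h.tail hlen] at h1
    set l : List (ℕ × List ℕ) := (List.range R.length).reverse.map fun j =>
      (R.getD j 0, T.filterMap fun R => R[j]?) with hldef
    have e1 : colsWord R.length (R :: T) = l.flatMap fun p => p.1 :: p.2 := by
      rw [colsWord, hldef, List.flatMap_map]
      refine List.flatMap_congr fun j hj => ?_
      have hj : j < R.length := by simpa using hj
      rw [List.filterMap_cons_some (f := fun R : List ℕ => R[j]?) (List.getElem?_eq_getElem hj)]
      simp [hj]
    have e2 : l.map Prod.fst = R.reverse := by
      rw [hldef, List.map_map, List.map_reverse]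
      congr 1
      refine List.ext_getElem (by simp) fun j h1 h2 => ?_
      simp [h2]
    have e3 : l.flatMap Prod.snd = colsWord R.length T := by
      rw [colsWord, hldef, List.flatMap_map]
    have hl : ∀ p ∈ l, (p.1 :: p.2).Pairwise (· ≤ ·) := by
      intro p hp
      rw [hldef] at hp
      simp only [List.mem_map, List.mem_reverse, List.mem_range] at hp
      obtain ⟨j, hj, rfl⟩ := hp
      have hmem : (R :: T).filterMap (fun R => R[j]?) ∈ transpose (R :: T) := by
        simp only [transpose, List.mem_map, List.mem_range]
        exact ⟨j, hj, rfl⟩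
      have := h.transpose.row_sorted hmem
      rw [List.filterMap_cons_some (f := fun R : List ℕ => R[j]?)
        (List.getElem?_eq_getElem hj)] at this
      simpa [hj] using this.imp le_of_lt
    have hs : (l.map Prod.fst).Pairwise (· > ·) := by
      rw [e2, List.pairwise_reverse]
      exact h.row_sorted (by simp)
    have h2 := knuthEquiv_flatMap hs hl
    rw [← e1, e2, e3] at h2
    rw [rowWord_cons, List.reverse_append]
    exact h2.trans (h1.append_left _)

/-- Inserting a row `R` into a filling with first row `D`, where every entry of `D` is larger than
the entry of `R` in the same column, bumps the entries of `D` one by one. In the induction `u` is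
the part of `R` that has been inserted already. -/
theorem foldl_rowInsert_row {u D R : List ℕ} {T : Filling} (hs : (u ++ R).Pairwise (· < ·))
    (hD : ∀ j d : ℕ, D[j]? = some d → ∃ r < d, R[j]? = some r) :
    R.foldl rowInsert ((u ++ D) :: T) = (u ++ R) :: D.foldl rowInsert T := by
  induction R generalizing u D T with
  | nil =>
    cases D with
    | nil => rfl
    | cons d D =>
      obtain ⟨r, -, h⟩ := hD 0 d rfl
      simp at h
  | cons r R ih =>
    have hur : ∀ z ∈ u, ¬ r < z := fun z hz =>
      ((List.pairwise_append.1 hs).2.2 z hz r (by simp)).not_gt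
    have hs' : (u ++ [r] ++ R).Pairwise (· < ·) := by simpa using hs
    rw [List.foldl_cons]
    cases D with
    | nil =>
      have hb : bump (· < ·) r (u ++ []) = (u ++ [r] ++ [], none) := by
        simpa using bump_of_not hur
      rw [rowInsert, insertLines_cons_none hb, ih hs' (by simp)]
      simp
    | cons d D =>
      obtain ⟨r', hr', h⟩ := hD 0 d rfl
      obtain rfl : r = r' := by simpa using h
      have hb : bump (· < ·) r (u ++ d :: D) = (u ++ [r] ++ D, some d) := by
        simpa using bump_append hur hr'
      rw [rowInsert, insertLines_cons_some hb, ih hs' fun j d hd => hD (j + 1) d hd]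
      simp [rowInsert]

/-- Inserting the first row into the rest of a tableau restores the tableau. -/
theorem Valid.foldl_first_row {R : List ℕ} {T : Filling} (h : Valid (R :: T)) :
    R.foldl rowInsert T = R :: T := by
  induction T generalizing R with
  | nil =>
    have h1 : R.foldl rowInsert [[] ++ []] = [[] ++ R] :=
      foldl_rowInsert_row (by simpa using h.row_sorted (R := R) (by simp)) (by simp)
    cases R with
    | nil => exact absurd rfl (h.ne_nil [] (by simp))
    | cons r R => exact h1
  | cons D T ih =>
    have h1 : R.foldl rowInsert (([] ++ D) :: T) = ([] ++ R) :: D.foldl rowInsert T :=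
      foldl_rowInsert_row (by simpa using h.row_sorted (R := R) (by simp)) fun j d hd =>
        h.col 0 j d hd
    rw [ih h.tail] at h1
    exact h1

/-- Insertion of the row word of a tableau yields this tableau. -/
theorem Valid.foldl_rowWord {T : Filling} (h : Valid T) :
    (rowWord T).foldl rowInsert [] = T := by
  induction T with
  | nil => rfl
  | cons R T ih => rw [rowWord_cons, List.foldl_append, ih h.tail, h.foldl_first_row]

/-- Every standard tableau has a code. -/
theorem Valid.exists_code {T : Filling} (h : Valid T) (hn : T.flatten.Nodup) :
    ∃ F, IsStd F ∧ tab F = T := by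
  have hw := (rowWord_perm T).nodup_iff.2 hn
  obtain ⟨h1, h2, -⟩ := insWord_spec (F := []) ⟨trivial, .nil⟩ (w := rowWord T) (by simpa using hw)
  exact ⟨_, h2, by rw [← h1]; exact h.foldl_rowWord⟩

/-- Knuth equivalent standard tableaux are equal. -/
theorem Valid.eq_of_knuthEquiv {T T' : Filling} (h : Valid T) (h' : Valid T')
    (hn : T.flatten.Nodup) (hk : KnuthEquiv (rowWord T) (rowWord T')) : T = T' := by
  have hw := (rowWord_perm T).nodup_iff.2 hn
  have hw' := hk.reverse.1.nodup_iff.1 hw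
  have h1 := (insWord_spec (F := []) ⟨trivial, .nil⟩ (w := rowWord T) (by simpa using hw)).1
  have h2 := (insWord_spec (F := []) ⟨trivial, .nil⟩ (w := rowWord T') (by simpa using hw')).1
  rw [← h.foldl_rowWord, ← h'.foldl_rowWord]
  exact h1.trans ((congrArg tab (hk.insWord_eq [] hw)).trans h2.symm)

/-! ### The DDF map in terms of codes -/

theorem filterMap_eq_biword (I : ℕ → Option ℕ) (k : ℕ) :
    (List.range' 1 k).reverse.filterMap I = (biword I k).map Prod.snd := by
  induction k with
  | zero => rfl
  | succ k ih =>
    have : List.range' 1 (k + 1) = List.range' 1 k ++ [k + 1] := by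
      rw [List.range'_concat]; simp [add_comm]
    rw [this, List.reverse_append, List.reverse_singleton, List.singleton_append, biword]
    cases hI : I (k + 1) with
    | none => rw [List.filterMap_cons_none hI, ih]
    | some v => rw [List.filterMap_cons_some hI, ih]; rfl

/-- The tableau of the DDF map is the tableau of its code, and the involution of the DDF map has the
code of the transpose of `S` both as its insertion tableau and as its recording tableau. -/
theorem HighestWeight.ddfData_eq {b : List Letter} (h : HighestWeight b) :
    (ddfData b).1 = tab (codes b).1 ∧
    rsk (biword (ddfData b).2 b.length) = ((codes b).2, (codes b).2) ∧
    ∀ i, b.length < i → (ddfData b).2 i = none := by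
  induction b with
  | nil => exact ⟨rfl, rfl, fun _ _ => rfl⟩
  | cons x b ih =>
    obtain ⟨h1, h2, h5⟩ := ih h.1
    have hp := h.1.isPair
    have hv : ∀ p ∈ biword (ddfData b).2 b.length, p.2 < b.length + 1 := by
      intro p hpm
      have := letters_rsk_fst (biword (ddfData b).2 b.length)
      rw [h2] at this
      have := ((hp.mem p.2).1 (Or.inr (this.mem_iff.2 (List.mem_map_of_mem hpm)))).2
      omega
    have hx := h.2
    cases x with
    | zero => exact hx.elim
    | plain r =>
      refine ⟨by simp [ddfData, codes, addLetter, tab, h1], ?_, fun i hi => ?_⟩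
      · simp only [ddfData, List.length_cons, codes, addLetter]
        rw [biword, h5 _ (Nat.lt_succ_self _)]
        exact h2
      · exact h5 i ((Nat.lt_succ_self _).trans hi)
    | empty =>
      refine ⟨by simp [ddfData, codes, addLetter, h1], rsk_fixed hv h2, fun i hi => ?_⟩
      rw [List.length_cons] at hi
      simp only [ddfData]
      rw [Function.update_of_ne (by omega)]
      exact h5 i (by omega)
    | bar r =>
      have h3 := reverseInsert_tab hp.fst hx
      have ha : (del r (codes b).1).2 ∈ letters (codes b).1 :=
        (hp.fst.letters_del hx _).2 (Or.inl rfl)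
      have hr := (hp.mem _).1 (Or.inl ha)
      have hI : (ddfData b).2 (del r (codes b).1).2 = none := by
        by_contra hne
        obtain ⟨v, hv⟩ := Option.ne_none_iff_exists'.1 hne
        have hm : ((del r (codes b).1).2, v) ∈ biword (ddfData b).2 b.length :=
          mem_biword.2 ⟨hr.1, hr.2, hv⟩
        have h4 := letters_rsk_snd (biword (ddfData b).2 b.length)
        rw [h2] at h4
        refine hp.disj _ ha ?_
        simp only at h4
        rw [h4]
        exact List.mem_map_of_mem hm
      refine ⟨by simp [ddfData, codes, addLetter, h1, h3], ?_, fun i hi => ?_⟩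
      · have := rsk_cycle hr.1 hr.2 hI hv h2
        simpa [ddfData, codes, addLetter, h1, h3] using this
      · rw [List.length_cons] at hi
        simp only [ddfData, h1, h3]
        rw [Function.update_of_ne (by omega), Function.update_of_ne (by omega)]
        exact h5 i (by omega)

/-- Column insertion of the lower word of a biword, starting at its right end, gives the transpose
of the insertion tableau. -/
theorem foldr_colInsert {w : List (ℕ × ℕ)} (hw : (w.map Prod.snd).Nodup) :
    IsStd (rsk w).1 ∧ (w.map Prod.snd).foldr colInsert [] = transpose (tab (rsk w).1) := by
  induction w with
  | nil => exact ⟨⟨trivial, .nil⟩, rfl⟩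
  | cons p w ih =>
    rw [List.map_cons, List.nodup_cons] at hw
    obtain ⟨h1, h2⟩ := ih hw.2
    have h3 : p.2 ∉ letters (rsk w).1 := by
      rw [(letters_rsk_fst w).mem_iff]
      exact hw.1
    refine ⟨h1.ins h3, ?_⟩
    rw [List.map_cons, List.foldr_cons, h2, colInsert_transpose_tab h1 h3]
    rfl

theorem rsk_fst (w : List (ℕ × ℕ)) : (rsk w).1 = insWord [] (w.map Prod.snd).reverse := by
  induction w with
  | nil => rfl
  | cons p w ih => simp [rsk, ih, insWord]

theorem HighestWeight.ddfWord_perm {b : List Letter} (h : HighestWeight b) :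
    (ddfWord b).Perm (letters (codes b).2) := by
  have := letters_rsk_fst (biword (ddfData b).2 b.length)
  rw [h.ddfData_eq.2.1] at this
  rw [ddfWord, filterMap_eq_biword]
  exact this.symm

theorem HighestWeight.ddfT_eq {b : List Letter} (h : HighestWeight b) :
    ddfT b = tab (codes b).1 := h.ddfData_eq.1

theorem HighestWeight.ddfS_eq {b : List Letter} (h : HighestWeight b) :
    ddfS b = transpose (tab (codes b).2) := by
  have hn : (ddfWord b).Nodup := h.ddfWord_perm.nodup_iff.2 h.isPair.snd.nodup
  rw [ddfWord, filterMap_eq_biword] at hn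
  have := (foldr_colInsert hn).2
  rw [h.ddfData_eq.2.1] at this
  rw [ddfS, ddfWord, filterMap_eq_biword, this]

theorem HighestWeight.nodup_append {b : List Letter} (h : HighestWeight b) :
    (letters (codes b).1 ++ ddfWord b).Nodup := by
  rw [(h.ddfWord_perm.append_left _).nodup_iff, List.nodup_append]
  refine ⟨h.isPair.fst.nodup, h.isPair.snd.nodup, fun x hx y hy hxy => ?_⟩
  exact h.isPair.disj x hx (hxy ▸ hy)

/-- The row word of `S` is Knuth equivalent to the word from which `S` is built. -/
theorem HighestWeight.rowWord_ddfS {b : List Letter} (h : HighestWeight b) :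
    KnuthEquiv (rowWord (ddfS b)) (ddfWord b) := by
  have hn : (ddfWord b).Nodup := h.ddfWord_perm.nodup_iff.2 h.isPair.snd.nodup
  have hn' : (letters [] ++ (ddfWord b).reverse).Nodup := by simpa using hn
  have h0 : IsStd [] := ⟨trivial, .nil⟩
  have e : (codes b).2 = insWord [] (ddfWord b).reverse := by
    have := rsk_fst (biword (ddfData b).2 b.length)
    rwa [h.ddfData_eq.2.1, ← filterMap_eq_biword] at this
  have h1 := rowWord_foldl_rowInsert h0 hn'
  rw [(insWord_spec h0 hn').1, ← e] at h1
  have h2 : KnuthEquiv (rowWord (tab (codes b).2)) (ddfWord b).reverse := h1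
  have h3 := h2.reverse.2 ((rowWord_perm _).nodup_iff.2 h.isPair.snd.nodup_tab)
  rw [List.reverse_reverse] at h3
  rw [h.ddfS_eq]
  exact (rowWord_transpose_equiv h.isPair.snd.valid).trans h3

/-- `P = [T · S]`. -/
theorem HighestWeight.rowWord_ddfP {b : List Letter} (h : HighestWeight b) :
    KnuthEquiv (rowWord (ddfT b) ++ rowWord (ddfS b)) (rowWord (ddfP b)) := by
  have := rowWord_foldl_rowInsert h.isPair.fst h.nodup_append
  rw [ddfP, h.ddfT_eq]
  exact (h.rowWord_ddfS.append_left _).trans this.symm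

/-! ### Yamanouchi words -/

/-- The Yamanouchi word of a code. -/
def codeWord (H : Code) : List Letter := H.map fun p => .plain p.2

theorem range'_succ_reverse (k : ℕ) :
    (List.range' 1 (k + 1)).reverse = (k + 1) :: (List.range' 1 k).reverse := by
  rw [List.range'_concat]; simp [add_comm]

theorem letters_eq_range' {H : Code} (h : IsStd H) {k : ℕ}
    (hm : ∀ x, x ∈ letters H ↔ 1 ≤ x ∧ x ≤ k) : letters H = (List.range' 1 k).reverse := by
  have hs : (List.range' 1 k).reverse.Pairwise (· > ·) := by
    rw [List.pairwise_reverse]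
    exact List.pairwise_lt_range'
  refine ((List.perm_ext_iff_of_nodup h.nodup
    (hs.imp fun h => ne_of_gt h)).2 fun x => ?_).eq_of_pairwise
    (fun a b _ _ h1 h2 => by omega) h.sorted hs
  rw [hm, List.mem_reverse, List.mem_range'_1]
  omega

/-- The word of a code of a standard tableau with letters `1, …, k` is a highest weight word, and
the DDF map recovers the code. -/
theorem codes_codeWord {H : Code} (h : Yam H) {k : ℕ}
    (hl : letters H = (List.range' 1 k).reverse) :
    (codeWord H).length = k ∧ codes (codeWord H) = (H, []) ∧ HighestWeight (codeWord H) := by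
  induction k generalizing H with
  | zero =>
    obtain rfl : H = [] := by simpa using hl
    exact ⟨rfl, rfl, trivial⟩
  | succ k ih =>
    rw [range'_succ_reverse] at hl
    cases H with
    | nil => simp at hl
    | cons p H =>
      rw [letters, List.map_cons, List.cons_eq_cons] at hl
      obtain ⟨h1, h2, h3⟩ := ih h.1 hl.2
      refine ⟨by simpa [codeWord] using h1, ?_, h3, ?_⟩
      · change addLetter ((codeWord H).length + 1) (.plain p.2) (codes (codeWord H)) = _
        rw [h1, h2, ← hl.1]
        rfl
      · change Fits (codes (codeWord H)).1 (.plain p.2)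
        rw [h2]
        exact h.2

/-- For a word in unbarred letters, the tableau `T` of the DDF map is the standard tableau of the
word. -/
theorem codeWord_codes {c : List Letter} (h : ∀ x ∈ c, ∃ r, x = .plain r) :
    codeWord (codes c).1 = c ∧ stdTableau c = tab (codes c).1 ∧ (codes c).2 = [] := by
  induction c with
  | nil => exact ⟨rfl, rfl, rfl⟩
  | cons x c ih =>
    rw [List.forall_mem_cons] at h
    obtain ⟨⟨r, rfl⟩, h⟩ := h
    obtain ⟨h1, h2, h3⟩ := ih h
    refine ⟨?_, ?_, h3⟩
    · simpa [codes, addLetter, codeWord] using h1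
    · simp [codes, addLetter, stdTableau, tab, h2]

theorem findIdx_tab {H : Code} (h : IsStd H) {p : ℕ × ℕ} (hp : p ∈ H) :
    (tab H).findIdx (fun R => decide (p.1 ∈ R)) = p.2 := by
  have hmem : p.1 ∈ (tab H).getD p.2 [] := (mem_getD_tab h).2 hp
  have hlt : p.2 < (tab H).length := by
    by_contra hle
    rw [List.getD_eq_getElem?_getD, List.getElem?_eq_none (not_lt.1 hle)] at hmem
    simp at hmem
  rw [List.findIdx_eq hlt]
  rw [List.getD_eq_getElem?_getD, List.getElem?_eq_getElem hlt, Option.getD_some] at hmem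
  refine ⟨by simpa using hmem, fun j hj => ?_⟩
  rw [decide_eq_false_iff_not]
  intro hmj
  have h1 : (p.1, j) ∈ H := by
    rw [← mem_getD_tab h, List.getD_eq_getElem?_getD, List.getElem?_eq_getElem (hj.trans hlt)]
    exact hmj
  have := List.inj_on_of_nodup_map h.nodup h1 hp rfl
  have : j = p.2 := congrArg Prod.snd this
  omega

theorem yamanouchi_tab {H : Code} (h : IsStd H) {k : ℕ}
    (hl : letters H = (List.range' 1 k).reverse) : yamanouchi k (tab H) = codeWord H := by
  rw [yamanouchi, ← hl, letters, List.map_map, codeWord]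
  refine List.map_congr_left fun p hp => ?_
  simp [findIdx_tab h hp]

/-- The tableau `P` of the DDF map. -/
theorem HighestWeight.ddfP_spec {b : List Letter} (h : HighestWeight b) : ∃ H, IsStd H ∧
    letters H = (List.range' 1 b.length).reverse ∧ ddfP b = tab H ∧ ddfC b = codeWord H := by
  obtain ⟨h1, h2, h3⟩ := insWord_spec h.isPair.fst h.nodup_append
  have hl : letters (insWord (codes b).1 (ddfWord b)) = (List.range' 1 b.length).reverse := by
    refine letters_eq_range' h2 fun x => ?_
    rw [h3.mem_iff, List.mem_append, h.ddfWord_perm.mem_iff, h.isPair.mem]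
  have h4 : ddfP b = tab (insWord (codes b).1 (ddfWord b)) := by rw [ddfP, h.ddfT_eq, h1]
  exact ⟨_, h2, hl, h4, by rw [ddfC, h4, yamanouchi_tab h2 hl]⟩

/-! ### Even rows and fixed points -/

theorem altSum_eq_sum {F : Code} {M : ℕ} (h : ∀ p ∈ F, p.2 < M) :
    altSum F = ∑ j ∈ Finset.range M, (cnt j F : ℤ) * (-1) ^ j := by
  induction F with
  | nil => simp [altSum]
  | cons p F ih =>
    rw [List.forall_mem_cons] at h
    rw [altSum_cons, ih h.2]
    simp only [cnt_cons, Nat.cast_add, add_mul, Finset.sum_add_distrib, Nat.cast_ite, Nat.cast_one,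
      Nat.cast_zero, ite_mul, one_mul, zero_mul]
    rw [Finset.sum_ite_eq, if_pos (Finset.mem_range.2 h.1)]
    ring

/-- The alternating sum of the lengths of the columns of a diagram is the number of odd rows. -/
theorem sum_colLen_eq (μ : YoungDiagram) :
    ∑ j ∈ Finset.range (μ.rowLen 0), (μ.colLen j : ℤ) * (-1) ^ j =
      ∑ i ∈ Finset.range (μ.colLen 0), if Even (μ.rowLen i) then 0 else 1 := by
  have h1 : ∑ c ∈ μ.cells, (-1 : ℤ) ^ c.2 =
      ∑ j ∈ Finset.range (μ.rowLen 0), (μ.colLen j : ℤ) * (-1) ^ j := by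
    rw [← Finset.sum_fiberwise_of_maps_to (t := Finset.range (μ.rowLen 0)) (g := Prod.snd)]
    · refine Finset.sum_congr rfl fun j _ => ?_
      rw [Finset.sum_congr rfl (g := fun _ => (-1 : ℤ) ^ j)
        fun c hc => by rw [(Finset.mem_filter.1 hc).2], Finset.sum_const, nsmul_eq_mul,
        YoungDiagram.colLen_eq_card]
      rfl
    · intro c hc
      exact Finset.mem_range.2 (YoungDiagram.mem_iff_lt_rowLen.1
        (μ.up_left_mem (Nat.zero_le c.1) le_rfl hc))
  rw [← h1, ← Finset.sum_fiberwise_of_maps_to (t := Finset.range (μ.colLen 0)) (g := Prod.fst)]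
  · refine Finset.sum_congr rfl fun i _ => ?_
    have : (μ.cells.filter fun c => c.1 = i) = {i} ×ˢ Finset.range (μ.rowLen i) :=
      μ.row_eq_prod
    rw [this, Finset.sum_product, Finset.sum_singleton]
    exact neg_one_geom_sum
  · intro c hc
    exact Finset.mem_range.2 (YoungDiagram.mem_iff_lt_colLen.1
      (μ.up_left_mem le_rfl (Nat.zero_le c.2) hc))

theorem colLen_of_transpose {F : Code} (h : IsStd F) {μ : YoungDiagram}
    (hμ : IsTableau μ (transpose (tab F))) (j : ℕ) : μ.colLen j = cnt j F := by
  refine eq_of_forall_lt_iff fun i => ?_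
  rw [← YoungDiagram.mem_iff_lt_colLen, YoungDiagram.mem_iff_lt_rowLen, ← hμ.length_row,
    ← (tab_spec h).2.1, ← not_iff_not, not_lt, not_lt, ← List.getElem?_eq_none_iff,
    ← List.getElem?_eq_none_iff]
  have := h.valid.entry_transpose i j
  rw [entry, entry] at this
  rw [this]

/-- The rows of `S` are even if and only if the alternating sum of its column lengths vanishes. -/
theorem altSum_eq_zero_iff {F : Code} (h : IsStd F) {μ : YoungDiagram}
    (hμ : IsTableau μ (transpose (tab F))) : altSum F = 0 ↔ ∀ i, Even (μ.rowLen i) := by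
  have hcol := colLen_of_transpose h hμ
  have hM : ∀ p ∈ F, p.2 < μ.rowLen 0 := by
    intro p hp
    rw [← YoungDiagram.mem_iff_lt_rowLen, YoungDiagram.mem_iff_lt_colLen, hcol, cnt,
      List.count_pos_iff]
    exact List.mem_map_of_mem hp
  have h1 := altSum_eq_sum hM
  simp only [← hcol] at h1
  rw [h1, sum_colLen_eq, Finset.sum_eq_zero_iff_of_nonneg fun i _ => by split_ifs <;> simp]
  refine ⟨fun h i => ?_, fun h i _ => if_pos (h i)⟩
  by_cases hi : i < μ.colLen 0
  · have := h i (Finset.mem_range.2 hi)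
    by_contra hne
    simp [hne] at this
  · rw [← YoungDiagram.mem_iff_lt_colLen, YoungDiagram.mem_iff_lt_rowLen] at hi
    have : μ.rowLen i = 0 := by omega
    simp [this]

/-! ### The bijection -/

theorem mem_hwPaths_iff {d : Diamond} {n L : ℕ} (hn : L ≤ n) {lam : YoungDiagram}
    {b : List Letter} : b ∈ hwPaths d n L lam ↔ b.length = L ∧ (∀ x ∈ b, InB d n x) ∧
      HighestWeight b ∧ ∀ r, cnt r (codes b).1 = lam.rowLen r := by
  simp only [hwPaths, Set.mem_ofPred_eq]
  refine and_congr_right fun hl => and_congr_right fun hb => ?_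
  rw [highestWeight_iff hb (hl.trans_le hn)]
  refine and_congr_right fun hg => forall_congr' fun r => ?_
  rw [hg.wt_eq, Nat.cast_inj]

theorem IsStd.isTableau {F : Code} (h : IsStd F) {μ : YoungDiagram}
    (hμ : ∀ r, cnt r F = μ.rowLen r) : IsTableau μ (tab F) :=
  h.valid.isTableau fun i => by rw [(tab_spec h).2.1, hμ]

/-- The words of `P` are classical highest weight words of type `A`. -/
theorem codeWord_mem_hwPaths {n L : ℕ} (hn : L ≤ n) {H : Code} (h : IsStd H)
    (hl : letters H = (List.range' 1 L).reverse) :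
    ∃ τ : YoungDiagram, codeWord H ∈ hwPaths .empty n L τ := by
  obtain ⟨h1, h2, h3⟩ := codes_codeWord h.yam hl
  obtain ⟨τ, hτ⟩ := h.valid.exists_shape
  refine ⟨τ, (mem_hwPaths_iff hn).2 ⟨h1, fun x hx => ?_, h3, fun r => ?_⟩⟩
  · have hx' := hx
    simp only [codeWord, List.mem_map] at hx'
    obtain ⟨p, -, rfl⟩ := hx'
    have := h3.lt_length hx (Or.inl rfl)
    simp only [InB]
    omega
  · rw [h2, hτ, (tab_spec h).2.1]

theorem stdTableau_codeWord {k : ℕ} {H : Code} (h : IsStd H)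
    (hl : letters H = (List.range' 1 k).reverse) : stdTableau (codeWord H) = tab H := by
  have h1 := (codeWord_codes (c := codeWord H) fun x hx => by
    simp only [codeWord, List.mem_map] at hx
    obtain ⟨p, -, rfl⟩ := hx
    exact ⟨_, rfl⟩).2.1
  rwa [(codes_codeWord h.yam hl).2.1] at h1

theorem HighestWeight.stdTableau_ddfC {b : List Letter} (h : HighestWeight b) :
    stdTableau (ddfC b) = ddfP b := by
  obtain ⟨H, h1, h2, h3, h4⟩ := h.ddfP_spec
  rw [h3, h4, stdTableau_codeWord h1 h2]

/-- The shape of `S` can be tiled: in type `C` there are no letters `∅`, and their number is the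
number of odd rows of `S`. -/
theorem exists_tiled {d : Diamond} (hd : d = .box ∨ d = .domino) {n : ℕ} {b : List Letter}
    (hb : ∀ x ∈ b, InB d n x) (h : HighestWeight b) : ∃ μ ∈ tiled d, IsTableau μ (ddfS b) := by
  have hv := h.isPair.snd.valid.transpose
  obtain ⟨μ, hμ⟩ := hv.exists_shape
  have ht := hv.isTableau hμ
  refine ⟨μ, ?_, by rwa [h.ddfS_eq]⟩
  rcases hd with rfl | rfl
  · exact trivial
  · refine (altSum_eq_zero_iff h.isPair.snd ht).1 ?_
    rw [altSum_codes, Nat.cast_eq_zero, List.count_eq_zero]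
    intro hm
    simpa [InB] using hb _ hm

theorem mapsTo_ddfMap {d : Diamond} (hd : d = .box ∨ d = .domino) {n L : ℕ} (hn : L ≤ n)
    (lam : YoungDiagram) : Set.MapsTo ddfMap (hwPaths d n L lam) (target d n L lam) := by
  intro b hb
  obtain ⟨rfl, hB, hg, hw⟩ := (mem_hwPaths_iff hn).1 hb
  obtain ⟨μ, hμ, ht⟩ := exists_tiled hd hB hg
  obtain ⟨H, h1, h2, h3, h4⟩ := hg.ddfP_spec
  obtain ⟨τ, hτ⟩ := codeWord_mem_hwPaths hn h1 h2
  simp only [target, Set.mem_iUnion]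
  refine ⟨τ, μ, hμ, ?_, ?_, ht, ?_⟩
  · simpa only [ddfMap, h4] using hτ
  · simpa only [ddfMap, hg.ddfT_eq] using hg.isPair.fst.isTableau hw
  · simpa only [ddfMap, hg.stdTableau_ddfC] using hg.rowWord_ddfP

theorem injOn_ddfMap {d : Diamond} {n L : ℕ} (hn : L ≤ n)
    (lam : YoungDiagram) : Set.InjOn ddfMap (hwPaths d n L lam) := by
  intro b hb b' hb' he
  obtain ⟨hl, -, hg, -⟩ := (mem_hwPaths_iff hn).1 hb
  obtain ⟨hl', -, hg', -⟩ := (mem_hwPaths_iff hn).1 hb'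
  simp only [ddfMap, Prod.mk.injEq] at he
  obtain ⟨-, hT, hS⟩ := he
  rw [hg.ddfT_eq, hg'.ddfT_eq] at hT
  rw [hg.ddfS_eq, hg'.ddfS_eq] at hS
  have hS' := congrArg transpose hS
  rw [hg.isPair.snd.valid.transpose_transpose, hg'.isPair.snd.valid.transpose_transpose] at hS'
  exact hg.codes_injective hg' (hl.trans hl'.symm)
    (Prod.ext (tab_injective hg.isPair.fst hg'.isPair.fst hT)
      (tab_injective hg.isPair.snd hg'.isPair.snd hS'))

theorem flatten_transpose_perm {F : Code} (h : IsStd F) :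
    (transpose (tab F)).flatten.Perm (tab F).flatten := by
  have := (rowWord_transpose_equiv h.valid).reverse.1
  exact (rowWord_perm _).symm.trans (this.trans ((List.reverse_perm _).trans (rowWord_perm _)))

theorem surjOn_ddfMap {d : Diamond} (hd : d = .box ∨ d = .domino) {n L : ℕ} (hn : L ≤ n)
    (lam : YoungDiagram) : Set.SurjOn ddfMap (hwPaths d n L lam) (target d n L lam) := by
  rintro ⟨c, T, S⟩ hp
  simp only [target, Set.mem_iUnion] at hp
  obtain ⟨τ, μ, hμ, hc, hT, hS, hk⟩ := hp
  simp only at hc hT hS hk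
  obtain ⟨hcl, hcB, hcg, -⟩ := (mem_hwPaths_iff hn).1 hc
  obtain ⟨hc1, hc2, hc3⟩ := codeWord_codes (c := c) fun x hx => by
    have := hcB x hx
    cases x <;> simp_all [InB]
  have hcp := hcg.isPair
  have hcm : ∀ x, x ∈ letters (codes c).1 ↔ 1 ≤ x ∧ x ≤ L := fun x => by
    have := hcp.mem x
    rw [hc3, hcl] at this
    simpa using this
  -- `T` and `S` have distinct letters and no common letters
  have hperm : (T.flatten ++ S.flatten).Perm (letters (codes c).1) := by
    refine (((rowWord_perm T).append (rowWord_perm S)).symm.trans hk.reverse.1).trans ?_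
    rw [hc2]
    exact (rowWord_perm _).trans (tab_spec hcp.fst).2.2
  have hnd := hperm.nodup_iff.2 hcp.fst.nodup
  rw [List.nodup_append] at hnd
  obtain ⟨hnT, hnS, hdisj⟩ := hnd
  have hvT := hT.valid hnT
  have hvS := hS.valid hnS
  obtain ⟨G, hG, rfl⟩ := hvT.exists_code hnT
  obtain ⟨F', hF', rfl⟩ := hvS.exists_code hnS
  obtain ⟨F, hF, hFT⟩ := hvS.transpose.exists_code
    ((flatten_transpose_perm hF').nodup_iff.2 hnS)
  have hSF : transpose (tab F) = tab F' := by rw [hFT, hvS.transpose_transpose]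
  have hFm : ∀ x, x ∈ letters F ↔ x ∈ (tab F').flatten := fun x => by
    rw [← hF.mem_tab, hFT, (flatten_transpose_perm hF').mem_iff]
  have hpair : IsPair L (G, F) := by
    refine ⟨hG, hF, fun x => ?_, fun x hx hx' => ?_⟩
    · rw [← hcm, ← hperm.mem_iff, List.mem_append, hG.mem_tab, hFm]
    · exact hdisj x (hG.mem_tab.2 hx) x ((hFm x).1 hx') rfl
  -- the codes of `T` and of the transpose of `S` determine the preimage
  obtain ⟨b, hb, hbl, hbc⟩ := hpair.exists_highestWeight
  have hbT : ddfT b = tab G := by rw [hb.ddfT_eq, hbc]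
  have hbS : ddfS b = tab F' := by rw [hb.ddfS_eq, hbc, hSF]
  have hbB : ∀ x ∈ b, InB d n x := by
    intro x hx
    cases x with
    | plain r =>
      have := hb.lt_length hx (Or.inl rfl)
      simp only [InB]; omega
    | bar r =>
      have := hb.lt_length hx (Or.inr rfl)
      refine ⟨?_, by omega⟩
      rcases hd with rfl | rfl <;> simp
    | zero => exact absurd hx hb.zero_notMem
    | empty =>
      rcases hd with rfl | rfl
      · rfl
      · -- the number of letters `∅` is the number of odd rows of `S`, which is zero
        exfalso
        have h1 := (altSum_eq_zero_iff hF (μ := μ) (by rwa [hSF])).2 hμ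
        have h2 := altSum_codes b
        rw [hbc, h1] at h2
        have h3 := List.count_pos_iff.2 hx
        omega
  refine ⟨b, (mem_hwPaths_iff hn).2 ⟨hbl, hbB, hb, fun r => ?_⟩, ?_⟩
  · rw [hbc, ← hT.length_row, (tab_spec hG).2.1]
  · -- both `P` and the standard tableau of `c` are the unique tableau in the class of `T · S`
    obtain ⟨H, h1, h2, h3, h4⟩ := hb.ddfP_spec
    have h5 := hb.rowWord_ddfP
    rw [hbT, hbS, h3] at h5
    rw [hc2] at hk
    have h6 := h1.valid.eq_of_knuthEquiv hcp.fst.valid h1.nodup_tab (h5.symm.trans hk)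
    have h7 := tab_injective h1 hcp.fst h6
    rw [ddfMap, hbT, hbS, h4, h7, hc1]

end DDF

theorem proposition55 (d : DDF.Diamond) (hd : d = .box ∨ d = .domino) (n L : ℕ) (hn : L ≤ n)
    (lam : YoungDiagram) :
    Set.BijOn DDF.ddfMap (DDF.hwPaths d n L lam) (DDF.target d n L lam) ∧
    ∀ b ∈ DDF.hwPaths d n L lam,
      (∃ μ ∈ DDF.tiled d, DDF.IsTableau μ (DDF.ddfS b)) ∧
      DDF.stdTableau (DDF.ddfC b) = DDF.ddfP b ∧
      DDF.KnuthEquiv (DDF.rowWord (DDF.ddfT b) ++ DDF.rowWord (DDF.ddfS b))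
        (DDF.rowWord (DDF.ddfP b)) := by
  refine ⟨⟨DDF.mapsTo_ddfMap hd hn lam, DDF.injOn_ddfMap hn lam, DDF.surjOn_ddfMap hd hn lam⟩,
    fun b hb => ?_⟩
  obtain ⟨-, hB, hg, -⟩ := (DDF.mem_hwPaths_iff hn).1 hb
  exact ⟨DDF.exists_tiled hd hB hg, hg.stdTableau_ddfC, hg.rowWord_ddfP⟩
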